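/- **Tableaux.** A tableau is a semistandard Young tableau with integer entries (rows weakly increasing, columns strictly increasing); the product $P\cdot Q$ is obtained by row-inserting the entries of $Q$ into $P$, reading the rows of $Q$ from bottom to top and each row from left to right. Let $(b)^a$ denote the rectangle with $a\ge 0$ rows and $b\ge 0$ columns. If the shape of $W$ contains $(b)^a$, let $T$ be the part of $W$ in this rectangle (the first $a$ rows and first $b$ columns), $Q_0$ the part of $W$ below $T$ (rows $>a$, columns $\le b$), $P_0$ the part to the right of $T$ (rows $\le a$, columns $>b$) and $Z$ the remaining part (rows $>a$, columns $>b$). A *simple factorization* of $W$ with respect to $(b)^a$ is a factorization $W=Q\cdot T\cdot P$ such that $Q=Q_0\cdot\tilde Q$ and $P=\tilde P\cdot P_0$ for some factorization $Z=\tilde Q\cdot\tilde P$. Let $T$ be a tableau of shape $(b)^a$. For tableaux $X,Y$ all of whose entries are strictly larger than the entries of $T$, let $X_0$ be the first $b$ columns of $X$ and $\tilde X$ the rest of $X$, and let $Y_0$ be the first $a$ rows of $Y$ and $\tilde Y$ the rest of $Y$. Write $(X,Y)\models(X',Y')$ if either $X'=X_0\cdot M$ and $Y'=N\cdot Y$ for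 some factorization $\tilde X=M\cdot N$, or $X'=X\cdot M$ and $Y'=N\cdot Y_0$ for some factorization $\tilde Y=M\cdot N$. Let $\to$ be the transitive closure of $\models$ (it depends on $T$, $a$ and $b$). **Diagrams.** Let $n\ge 0$. A *rectangle diagram* consists of rectangles $R_{ij}$ for $0\le i<j\le n$, where $R_{ij}$ has $a_{ij}\ge 0$ rows and $b_{ij}\ge 0$ columns, such that $a_{i,j+1}\le a_{ij}$ and $b_{ij}\le b_{i+1,j}$ whenever these are defined. (For instance, rank conditions $r_{ij}$, $0\le i\le j\le n$, that occur for a sequence of linear maps give such a diagram with $a_{ij}=r_{i+1,j}-r_{ij}$ and $b_{ij}=r_{i,j-1}-r_{ij}$.) A *tableau diagram* consists of tableaux $T_{ij}$ of shape $R_{ij}$ such that every entry of $T_{ij}$ is strictly larger than every entry of $T_{kl}$ whenever $i\le k<l\le j$ and $(k,l)\ne(i,j)$. **Paths.** A *path* is a sequence of steps from $(0,0)$ to $(n,n)$ through points $(i,j)$ with $0\le i\le j\le n$, each step being down, $(i,j)\mapsto(i,j+1)$, up, $(i,j)\mapsto(i+1,j)$, or horizontal, $(i,j)\mapsto(i+1,j+1)$.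 Paths $\gamma,\gamma'$ are related as in *Case 1* if $\gamma'$ is obtained from $\gamma$ by replacing an up step that is immediately followed by a down step by one horizontal step. They are related as in *Case 2*, at the triangle $(i,j)$, if $\gamma'$ is obtained from $\gamma$ by replacing a horizontal step from $(i,j-1)$ to $(i+1,j)$ by a down step to $(i,j)$ followed by an up step to $(i+1,j)$. **Factor sequences.** Fix a tableau diagram. A *factor sequence* for a path is a labeling of its steps by tableaux, defined inductively. For the lowest path ($n$ down steps, then $n$ up steps) the only factor sequence is $(\emptyset,\dots,\emptyset)$. If $\gamma,\gamma'$ are related as in Case 1, $(\dots,W,\dots)$ is a factor sequence for $\gamma'$ with $W$ the label of the horizontal step in question, and $W=P\cdot Q$ is any factorization, then $(\dots,P,Q,\dots)$ is a factor sequence for $\gamma$. If $\gamma,\gamma'$ are related as in Case 2 at $(i,j)$ and $(\dots,Q,P,\dots)$ is a factor sequence for $\gamma'$ with $Q,P$ the labels of the two steps in question, then $(\dots,Q\cdot T_{ij}\cdot P,\dots)$ is a factor sequence for $\gamma$. **Statement.** Let $\gamma$ and $\gamma'$ be paths related as in Case 2 at $(i,j)$, and put $T=T_{ij}$, $a=a_{ij}$,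 $b=b_{ij}$. 1. Let $(\dots,W,\dots)$ be a factor sequence for $\gamma$, where $W$ labels the horizontal step in which $\gamma$ differs from $\gamma'$. Then $W$ contains $T$ in its upper-left corner, and if $W=Q\cdot T\cdot P$ is any simple factorization of $W$ with respect to $(b)^a$, then $(\dots,Q,P,\dots)$ is a factor sequence for $\gamma'$. 2. Let $(\dots,X,Y,\dots)$ be a factor sequence for $\gamma'$, where $X,Y$ label the two steps in which $\gamma'$ differs from $\gamma$. If $(X,Y)\to(X',Y')$, then $(\dots,X',Y',\dots)$ is a factor sequence for $\gamma'$. -/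

import Mathlib

namespace FactorSeq

/-! ### Semistandard Young tableaux with integer entries -/

/-- `Above r s`: the row `s` can be placed directly below the row `r` (both left justified),
i.e. `s` is not longer than `r` and every entry of `s` is strictly larger than the entry of `r`
in the same column. -/
def Above : List ℤ → List ℤ → Prop
  | _, [] => True
  | [], _ :: _ => False
  | x :: r, y :: s => x < y ∧ Above r s

/-- A list of rows (top to bottom) forms a semistandard Young tableau. -/
structure IsTableau (rows : List (List ℤ)) : Prop where
  ne_nil : ∀ r ∈ rows, r ≠ []
  row_weak : ∀ r ∈ rows, r.Pairwise (· ≤ ·)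
  col_strict : rows.IsChain Above

/-- A (semistandard Young) tableau with integer entries, given by its nonempty rows from top to
bottom. -/
@[ext]
structure Tableau where
  rows : List (List ℤ)
  isTableau : IsTableau rows

theorem Above.trans : ∀ {r s t : List ℤ}, Above r s → Above s t → Above r t
  | _, _, [], _, _ => by simp [Above]
  | _, [], _ :: _, _, h => by simp [Above] at h
  | [], _ :: _, _ :: _, h, _ => by simp [Above] at h
  | _ :: _, _ :: _, _ :: _, h, h' => ⟨h.1.trans h'.1, h.2.trans h'.2⟩

theorem Above.take : ∀ {r s : List ℤ} (b : ℕ), Above r s → Above (r.take b) (s.take b)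
  | _, [], _, _ => by simp [Above]
  | [], _ :: _, _, h => by simp [Above] at h
  | _ :: _, _ :: _, 0, _ => by simp [Above]
  | _ :: _, _ :: _, b + 1, h => ⟨h.1, h.2.take b⟩

theorem Above.drop : ∀ {r s : List ℤ} (b : ℕ), Above r s → Above (r.drop b) (s.drop b)
  | _, [], _, _ => by simp [Above]
  | [], _ :: _, _, h => by simp [Above] at h
  | _ :: _, _ :: _, 0, h => by simpa using h
  | _ :: _, _ :: _, b + 1, h => by simpa using h.2.drop b

theorem IsTableau.pairwise {rows : List (List ℤ)} (h : IsTableau rows) : rows.Pairwise Above :=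
  haveI : Trans Above Above Above := ⟨Above.trans⟩
  List.isChain_iff_pairwise.1 h.col_strict

/-- Apply `f` (cutting off columns) to every row, and discard the rows that became empty. -/
theorem IsTableau.mapFilter {rows : List (List ℤ)} (h : IsTableau rows) (f : List ℤ → List ℤ)
    (hf : ∀ r s, Above r s → Above (f r) (f s)) (hs : ∀ r, (f r).Sublist r) :
    IsTableau ((rows.map f).filter (fun r => !r.isEmpty)) where
  ne_nil r hr := by
    rw [List.mem_filter] at hr
    simpa using hr.2
  row_weak r hr := by
    rw [List.mem_filter, List.mem_map] at hr
    obtain ⟨⟨s, hs', rfl⟩, -⟩ := hr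
    exact (h.row_weak s hs').sublist (hs s)
  col_strict :=
    ((List.pairwise_map.2 (h.pairwise.imp (hf _ _))).filter _).isChain

namespace Tableau

/-- The empty tableau. -/
instance : EmptyCollection Tableau := ⟨⟨[], ⟨by simp, by simp, by simp⟩⟩⟩

/-- The length of the `i`-th row (rows are numbered from `0`), `0` if there is no such row. -/
def rowLen (T : Tableau) (i : ℕ) : ℕ := (T.rows.getD i []).length

/-- The reading word: the rows from bottom to top, each from left to right. -/
def word (T : Tableau) : List ℤ := T.rows.reverse.flatten

/-- `x` is the entry of some box of `T`. -/
def HasEntry (T : Tableau) (x : ℤ) : Prop := ∃ r ∈ T.rows, x ∈ r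

/-- The first `a` rows. -/
def top (a : ℕ) (T : Tableau) : Tableau :=
  ⟨T.rows.take a, fun r hr => T.isTableau.ne_nil r (List.mem_of_mem_take hr),
    fun r hr => T.isTableau.row_weak r (List.mem_of_mem_take hr), T.isTableau.col_strict.take a⟩

/-- The part below the first `a` rows. -/
def below (a : ℕ) (T : Tableau) : Tableau :=
  ⟨T.rows.drop a, fun r hr => T.isTableau.ne_nil r (List.mem_of_mem_drop hr),
    fun r hr => T.isTableau.row_weak r (List.mem_of_mem_drop hr), T.isTableau.col_strict.drop a⟩

/-- The first `b` columns. -/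
def left (b : ℕ) (T : Tableau) : Tableau :=
  ⟨(T.rows.map (List.take b)).filter (fun r => !r.isEmpty),
    T.isTableau.mapFilter _ (fun _ _ h => h.take b) (List.take_sublist b)⟩

/-- The part to the right of the first `b` columns. -/
def right (b : ℕ) (T : Tableau) : Tableau :=
  ⟨(T.rows.map (List.drop b)).filter (fun r => !r.isEmpty),
    T.isTableau.mapFilter _ (fun _ _ h => h.drop b) (List.drop_sublist b)⟩

end Tableau

/-! ### Row bumping and the product of tableaux -/

/-- Row-insert `x` into a row: `x` replaces the leftmost entry that is strictly larger than `x`,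
which is bumped out; if there is none, `x` is put at the end of the row and nothing is bumped. -/
def bump (x : ℤ) : List ℤ → Option ℤ × List ℤ
  | [] => (none, [x])
  | y :: r => if x < y then (some y, x :: r) else ((bump x r).1, y :: (bump x r).2)

/-- Row-insert `x` into the first row, the entry bumped out into the second row, and so on. -/
def insertRows : List (List ℤ) → ℤ → List (List ℤ)
  | [], x => [[x]]
  | r :: rs, x =>
    match (bump x r).1 with
    | none => (bump x r).2 :: rs
    | some y => (bump x r).2 :: insertRows rs y

theorem bump_ne_nil (x : ℤ) (r : List ℤ) : (bump x r).2 ≠ [] := by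
  cases r with
  | nil => simp [bump]
  | cons y r => by_cases h : x < y <;> simp [bump, h]

theorem mem_bump {x z : ℤ} : ∀ {r : List ℤ}, z ∈ (bump x r).2 → z = x ∨ z ∈ r
  | [], h => by simpa [bump] using h
  | y :: r, h => by
    by_cases hxy : x < y
    · simp only [bump, hxy, if_true, List.mem_cons] at h ⊢
      tauto
    · simp only [bump, hxy, if_false, List.mem_cons] at h ⊢
      rcases h with h | h
      · tauto
      · have := mem_bump h
        tauto

theorem bump_sorted {x : ℤ} : ∀ {r : List ℤ}, r.Pairwise (· ≤ ·) →
    (bump x r).2.Pairwise (· ≤ ·)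
  | [], _ => by simp [bump]
  | y :: r, h => by
    rw [List.pairwise_cons] at h
    by_cases hxy : x < y
    · simp only [bump, hxy, if_true, List.pairwise_cons]
      exact ⟨fun z hz => hxy.le.trans (h.1 z hz), h.2⟩
    · simp only [bump, hxy, if_false, List.pairwise_cons]
      refine ⟨fun z hz => ?_, bump_sorted h.2⟩
      rcases mem_bump hz with rfl | hz
      · exact not_lt.1 hxy
      · exact h.1 z hz

theorem lt_of_bump {x y : ℤ} : ∀ {r : List ℤ}, (bump x r).1 = some y → x < y
  | [], h => by simp [bump] at h
  | z :: r, h => by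
    by_cases hxz : x < z
    · simp only [bump, hxz, if_true, Option.some.injEq] at h
      exact h ▸ hxz
    · simp only [bump, hxz, if_false] at h
      exact lt_of_bump h

theorem Above.bump {x : ℤ} : ∀ {r s : List ℤ}, Above r s → Above (bump x r).2 s
  | _, [], _ => by simp [Above]
  | [], _ :: _, h => by simp [Above] at h
  | y :: r, z :: s, h => by
    by_cases hxy : x < y
    · simp only [FactorSeq.bump, hxy, if_true]
      exact ⟨hxy.trans h.1, h.2⟩
    · simp only [FactorSeq.bump, hxy, if_false]
      exact ⟨h.1, h.2.bump⟩

theorem Above.bump_bump {x y : ℤ} : ∀ {r s : List ℤ}, Above r s →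
    (FactorSeq.bump x r).1 = some y →
    Above (FactorSeq.bump x r).2 (FactorSeq.bump y s).2
  | [], _, _, h => by simp [FactorSeq.bump] at h
  | u :: r, s, hrs, h => by
    by_cases hxu : x < u
    · simp only [FactorSeq.bump, hxu, if_true, Option.some.injEq] at h ⊢
      subst h
      cases s with
      | nil => simp [FactorSeq.bump, Above, hxu]
      | cons v s => simpa [FactorSeq.bump, Above, hrs.1, hxu] using hrs.2
    · simp only [FactorSeq.bump, hxu, if_false] at h ⊢
      have huy : u < y := (not_lt.1 hxu).trans_lt (lt_of_bump h)
      cases s with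
      | nil => simp [FactorSeq.bump, Above, huy]
      | cons v s =>
        by_cases hyv : y < v
        · simp only [FactorSeq.bump, hyv, if_true]
          exact ⟨huy, hrs.2.bump⟩
        · simp only [FactorSeq.bump, hyv, if_false]
          exact ⟨hrs.1, hrs.2.bump_bump h⟩

theorem IsTableau.tail {r : List ℤ} {rs : List (List ℤ)} (h : IsTableau (r :: rs)) :
    IsTableau rs :=
  ⟨fun s hs => h.ne_nil s (List.mem_cons_of_mem _ hs),
    fun s hs => h.row_weak s (List.mem_cons_of_mem _ hs), h.col_strict.tail⟩

theorem IsTableau.cons {r : List ℤ} {rs : List (List ℤ)} (h : IsTableau rs) (h0 : r ≠ [])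
    (h1 : r.Pairwise (· ≤ ·)) (h2 : ∀ s ∈ rs.head?, Above r s) : IsTableau (r :: rs) where
  ne_nil := by
    simpa [h0] using h.ne_nil
  row_weak := by
    simpa [h1] using h.row_weak
  col_strict := List.isChain_cons.2 ⟨h2, h.col_strict⟩

theorem IsTableau.insertRows : ∀ {rs : List (List ℤ)} (x : ℤ), IsTableau rs →
    IsTableau (insertRows rs x)
  | [], x, _ => ⟨by simp [FactorSeq.insertRows], by simp [FactorSeq.insertRows],
      by simp [FactorSeq.insertRows]⟩
  | r :: rs, x, h => by
    have hr := bump_sorted (x := x) (h.row_weak r (by simp))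
    have hc := (List.isChain_cons.1 h.col_strict).1
    cases hb : (bump x r).1 with
    | none =>
      simp only [FactorSeq.insertRows, hb]
      exact h.tail.cons (bump_ne_nil x r) hr fun s hs => (hc s hs).bump
    | some y =>
      simp only [FactorSeq.insertRows, hb]
      refine (h.tail.insertRows y).cons (bump_ne_nil x r) hr ?_
      intro s hs
      cases rs with
      | nil =>
        simp only [FactorSeq.insertRows, List.head?_cons, Option.mem_def,
          Option.some.injEq] at hs
        subst hs
        have : Above r [] := by simp [Above]
        simpa [bump] using this.bump_bump hb
      | cons t rs =>
        have ht : s = (bump y t).2 := by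
          cases hb' : (bump y t).1 <;>
            simp only [FactorSeq.insertRows, hb', List.head?_cons, Option.mem_def,
              Option.some.injEq] at hs <;> exact hs.symm
        subst ht
        exact (hc t (by simp)).bump_bump hb

namespace Tableau

/-- Row-insertion of an integer into a tableau. -/
def insert (T : Tableau) (x : ℤ) : Tableau := ⟨insertRows T.rows x, T.isTableau.insertRows x⟩

/-- The product `P · Q` of tableaux: the entries of `Q` are row-inserted into `P`, from the bottom
row of `Q` to its top row and from left to right in each row. -/
instance : Mul Tableau := ⟨fun P Q => Q.word.foldl insert P⟩

/-- The shape of `W` contains the rectangle with `a` rows and `b` columns. -/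
def ContainsRect (a b : ℕ) (W : Tableau) : Prop := ∀ i < a, b ≤ W.rowLen i

/-- The shape of `T` is the rectangle with `a` rows and `b` columns. -/
def IsRect (a b : ℕ) (T : Tableau) : Prop := ∀ i, T.rowLen i = if i < a then b else 0

/-- `W` contains the tableau `T`, whose shape is the rectangle with `a` rows and `b` columns, in
its upper-left corner. -/
def HasCorner (a b : ℕ) (W T : Tableau) : Prop := W.ContainsRect a b ∧ T = (W.top a).left b

end Tableau

/-- `W = Q · T · P` is a simple factorization of `W` with respect to the rectangle with `a` rows
and `b` columns: `T` is the part of `W` in this rectangle, and `Q = Q₀ · Q'`, `P = P' · P₀` for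
some factorization `Z = Q' · P'`, where `Q₀` is the part of `W` below `T`, `P₀` the part to the
right of `T`, and `Z` the remaining part of `W`. -/
structure IsSimpleFactorization (a b : ℕ) (W Q T P : Tableau) : Prop where
  corner : W.HasCorner a b T
  eq_mul : W = Q * T * P
  exists_factor : ∃ Q' P' : Tableau, (W.below a).right b = Q' * P' ∧
    Q = (W.below a).left b * Q' ∧ P = P' * (W.top a).right b

/-- The relation `(X, Y) ⊨ (X', Y')` with respect to a tableau `T` of rectangular shape with `a`
rows and `b` columns. -/
def Models (a b : ℕ) (T : Tableau) (p p' : Tableau × Tableau) : Prop :=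
  (∀ t, T.HasEntry t → (∀ x, p.1.HasEntry x → t < x) ∧ (∀ y, p.2.HasEntry y → t < y)) ∧
  ((∃ M N : Tableau, p.1.right b = M * N ∧ p'.1 = p.1.left b * M ∧ p'.2 = N * p.2) ∨
   (∃ M N : Tableau, p.2.below a = M * N ∧ p'.1 = p.1 * M ∧ p'.2 = N * p.2.top a))

/-- The relation `(X, Y) → (X', Y')`: the transitive closure of `⊨`. -/
def Leads (a b : ℕ) (T : Tableau) : Tableau × Tableau → Tableau × Tableau → Prop :=
  Relation.TransGen (Models a b T)

/-! ### Rectangle diagrams and tableau diagrams -/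

/-- A rectangle diagram: rectangles `R i j` for `0 ≤ i < j ≤ n`, arranged in a triangle with the
`R i (i+1)` in its top row and `R 0 n` at the bottom. The rectangles get shorter when one moves
south-east (from `R i j` to `R i (j+1)`) and narrower when one moves south-west (from `R (i+1) j`
to `R i j`). Values outside `i < j ≤ n` are irrelevant. -/
structure RectDiagram (n : ℕ) where
  numRows : ℕ → ℕ → ℕ
  numCols : ℕ → ℕ → ℕ
  numRows_le : ∀ i j, i < j → j + 1 ≤ n → numRows i (j + 1) ≤ numRows i j
  numCols_le : ∀ i j, i + 1 < j → j ≤ n → numCols i j ≤ numCols (i + 1) j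

/-- The rectangle diagram of rank conditions `r i j`, `0 ≤ i ≤ j ≤ n`, that can occur. -/
def RectDiagram.ofRank (n : ℕ) (r : ℕ → ℕ → ℕ)
    (h₁ : ∀ i j, i < j → j ≤ n → r i j ≤ r i (j - 1) ∧ r i j ≤ r (i + 1) j)
    (h₂ : ∀ i j, i + 2 ≤ j → j ≤ n → r i (j - 1) + r (i + 1) j ≤ r i j + r (i + 1) (j - 1)) :
    RectDiagram n where
  numRows i j := r (i + 1) j - r i j
  numCols i j := r i (j - 1) - r i j
  numRows_le i j hij hj := by
    have a := h₁ i (j + 1) (by omega) hj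
    have b := h₁ i j hij (by omega)
    have c := h₂ i (j + 1) (by omega) hj
    simp only [Nat.add_sub_cancel] at a c
    omega
  numCols_le i j hij hj := by
    have a := h₁ i j (by omega) hj
    have b := h₁ (i + 1) j hij hj
    have c := h₂ i j (by omega) hj
    omega

/-- A tableau diagram: a filling of the boxes of a rectangle diagram with integers, such that each
rectangle becomes a tableau `T i j`, the entries of which are strictly larger than the entries of
all `T k l` with `i ≤ k < l ≤ j` and `(k, l) ≠ (i, j)`. -/
structure TableauDiagram {n : ℕ} (R : RectDiagram n) where
  T : ℕ → ℕ → Tableau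
  isRect : ∀ i j, i < j → j ≤ n → (T i j).IsRect (R.numRows i j) (R.numCols i j)
  entry_lt : ∀ i j k l, i ≤ k → k < l → l ≤ j → j ≤ n → (k, l) ≠ (i, j) →
    ∀ x y, (T k l).HasEntry x → (T i j).HasEntry y → x < y

/-! ### Paths through the rank diagram

The rank diagram is the triangle of points `(i, j)`, `0 ≤ i ≤ j ≤ n`; the point `(i, j)` is in
row `j - i` (counted downwards) and has horizontal coordinate `i + j`. -/

/-- The line segments between neighboring points, travelled from left to right:
`down` goes from `(i, j)` to `(i, j + 1)`, `up` from `(i, j)` to `(i + 1, j)`, and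
`horiz` from `(i, j)` to `(i + 1, j + 1)`. -/
inductive Step
  | down
  | up
  | horiz
  deriving DecidableEq

open Step

/-- The point reached from `(0, 0)` after a sequence of steps. -/
def endpoint (γ : List Step) : ℕ × ℕ :=
  (γ.count up + γ.count horiz, γ.count down + γ.count horiz)

/-- A path through the rank diagram: it goes from `(0, 0)` to `(n, n)` inside the triangle. -/
def IsPath (n : ℕ) (γ : List Step) : Prop :=
  endpoint γ = (n, n) ∧ ∀ δ, δ <+: γ → (endpoint δ).1 ≤ (endpoint δ).2

/-- The path `γ` is obtained from the lower path `γ'` by replacing a horizontal segment, preceded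
by the steps `α`, by an up-going and a down-going segment. -/
structure IsCase1 (n : ℕ) (α : List Step) (γ γ' : List Step) : Prop where
  isPath : IsPath n γ
  isPath' : IsPath n γ'
  exists_rest : ∃ β, γ = α ++ [up, down] ++ β ∧ γ' = α ++ [horiz] ++ β

/-- The path `γ` is obtained from the lower path `γ'` by replacing a down-going and an up-going
segment, preceded by the steps `α`, by a horizontal segment. The triangle between the two paths
has the vertices `(i, j - 1)`, `(i, j)`, `(i + 1, j)`, where `(i, j - 1)` is the endpoint
of `α`. -/
structure IsCase2 (n : ℕ) (α : List Step) (i j : ℕ) (γ γ' : List Step) : Prop where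
  isPath : IsPath n γ
  isPath' : IsPath n γ'
  exists_rest : ∃ β, γ = α ++ [horiz] ++ β ∧ γ' = α ++ [down, up] ++ β
  start : endpoint α = (i, j - 1)
  pos : 0 < j

/-- `IsFactorSeq 𝒯 γ L`: the sequence of tableaux `L`, regarded as a labeling of the segments of
the path `γ` from left to right, is a factor sequence for `γ`. -/
inductive IsFactorSeq {n : ℕ} {R : RectDiagram n} (𝒯 : TableauDiagram R) :
    List Step → List Tableau → Prop
  | lowest : IsFactorSeq 𝒯 (List.replicate n down ++ List.replicate n up)
      (List.replicate (2 * n) ∅)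
  | case1 {α γ γ' : List Step} {A B : List Tableau} (P Q : Tableau)
      (hγ : IsCase1 n α γ γ') (hA : A.length = α.length)
      (h : IsFactorSeq 𝒯 γ' (A ++ [P * Q] ++ B)) :
      IsFactorSeq 𝒯 γ (A ++ [P, Q] ++ B)
  | case2 {α γ γ' : List Step} {i j : ℕ} {A B : List Tableau} (Q P : Tableau)
      (hγ : IsCase2 n α i j γ γ') (hA : A.length = α.length)
      (h : IsFactorSeq 𝒯 γ' (A ++ [Q, P] ++ B)) :
      IsFactorSeq 𝒯 γ (A ++ [Q * 𝒯.T i j * P] ++ B)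

end FactorSeq

/-!
The product of tableaux is associative because row insertion is invariant under the Knuth relations.

Let `T` be a rectangle whose entries are smaller than those of `X` and `Y`. Alternately moving the
part of `X` to the right of its first `b` columns into `Y`, and the part of `Y` below its first `a`
rows into `X`, does not change `X · T · Y`. Once the first `b` columns of `X` no longer grow,
`T` sits in the upper left corner of `X · T · Y`, and `X` and `Y` are the parts of this product
below the first `a` rows and to the right of `T`. So every pair leads to this one, and one more step
leads to any simple factorization.

Both parts of the theorem thus reduce to one step `⊨`, which moves a factor of one label past the
vertex `(i, j)` into the other label. If a factor `N` is to leave `X`, lower the path before `X`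
until an up step precedes it, and merge these two steps into a horizontal one. By induction its
label has a simple factorization at the triangle `(i - 1, j)`, in which the last step goes up, and
after an up step a factor passes a vertex freely: the path behind the vertex can be lowered so that
both steps merge. Since `b_{i-1,j} ≤ b_{ij}`, the product with `N` does not affect the columns that
belong to this triangle, so that undoing the changes of the path gives `X` without `N`. Moving a
factor out of `Y` is symmetric, with rows in place of columns and the triangle `(i, j + 1)` in place
of `(i - 1, j)`. The induction is on `i + (n - j)`.
-/

namespace FactorSeq

/-! ### Knuth equivalence and associativity of the product -/

section Knuth

/-- The elementary Knuth relations, each read in one direction only. -/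
inductive KnuthStep : List ℤ → List ℤ → Prop
  | yzx {x y z : ℤ} : x < y → y ≤ z → KnuthStep [y, z, x] [y, x, z]
  | xzy {x y z : ℤ} : x ≤ y → y < z → KnuthStep [x, z, y] [z, x, y]

/-- Knuth (plactic) equivalence of words: the congruence generated by `KnuthStep`. -/
inductive KnuthEq : List ℤ → List ℤ → Prop
  | refl (w) : KnuthEq w w
  | symm {v w} : KnuthEq v w → KnuthEq w v
  | trans {u v w} : KnuthEq u v → KnuthEq v w → KnuthEq u w
  | append {v w} (p s : List ℤ) : KnuthEq v w → KnuthEq (p ++ v ++ s) (p ++ w ++ s)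
  | of_step {v w} : KnuthStep v w → KnuthEq v w

theorem KnuthEq.append_left {v w : List ℤ} (p : List ℤ) (h : KnuthEq v w) :
    KnuthEq (p ++ v) (p ++ w) := by
  simpa using h.append p []

theorem KnuthEq.append_right {v w : List ℤ} (s : List ℤ) (h : KnuthEq v w) :
    KnuthEq (v ++ s) (w ++ s) := by
  simpa using h.append [] s

theorem KnuthEq.cons {v w : List ℤ} (a : ℤ) (h : KnuthEq v w) : KnuthEq (a :: v) (a :: w) :=
  h.append_left [a]

theorem KnuthStep.perm {v w : List ℤ} : KnuthStep v w → v.Perm w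
  | .yzx _ _ => (List.Perm.swap _ _ _).cons _
  | .xzy _ _ => List.Perm.swap _ _ _

theorem KnuthEq.perm {v w : List ℤ} (h : KnuthEq v w) : v.Perm w := by
  induction h with
  | refl => exact .refl _
  | symm _ ih => exact ih.symm
  | trans _ _ ih₁ ih₂ => exact ih₁.trans ih₂
  | append p s _ ih => exact (ih.append_left p).append_right s
  | of_step h => exact h.perm

theorem bump_append_of_forall_le {x : ℤ} {u : List ℤ} (h : ∀ z ∈ u, z ≤ x) (r : List ℤ) :
    bump x (u ++ r) = ((bump x r).1, u ++ (bump x r).2) := by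
  induction u with
  | nil => rfl
  | cons a u ih =>
    rw [List.forall_mem_cons] at h
    simp [bump, not_lt.2 h.1, ih h.2]

theorem bump_cases (x : ℤ) (r : List ℤ) :
    (bump x r = (none, r ++ [x]) ∧ ∀ y ∈ r, y ≤ x) ∨
      ∃ u a s, r = u ++ a :: s ∧ (∀ y ∈ u, y ≤ x) ∧ x < a ∧ bump x r = (some a, u ++ x :: s) := by
  induction r with
  | nil => simp [bump]
  | cons b r ih =>
    rcases lt_or_ge x b with hxb | hbx
    · exact .inr ⟨[], b, r, rfl, by simp, hxb, by simp [bump, hxb]⟩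
    · rcases ih with ⟨hb, h⟩ | ⟨u, a, s, rfl, hu, hxa, hb⟩
      · exact .inl ⟨by simp [bump, not_lt.2 hbx, hb], List.forall_mem_cons.2 ⟨hbx, h⟩⟩
      · exact .inr ⟨b :: u, a, s, rfl, List.forall_mem_cons.2 ⟨hbx, hu⟩, hxa,
          by simp [bump, not_lt.2 hbx, hb]⟩

theorem mem_of_bump_eq_some {x y : ℤ} {r : List ℤ} (h : (bump x r).1 = some y) : y ∈ r := by
  rcases bump_cases x r with ⟨hb, -⟩ | ⟨u, a, s, rfl, -, -, hb⟩ <;> simp_all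

/-- Row-insert the letters of a word into a single row; the first component is the word of the
bumped letters, in the order in which they are bumped. -/
def bumpWord : List ℤ → List ℤ → List ℤ × List ℤ
  | r, [] => ([], r)
  | r, x :: w => ((bump x r).1.toList ++ (bumpWord (bump x r).2 w).1, (bumpWord (bump x r).2 w).2)

/-- Row-insert the letters of a word into a list of rows. -/
def insertWord (rs : List (List ℤ)) (w : List ℤ) : List (List ℤ) := w.foldl insertRows rs

theorem bumpWord_append_of_forall_le {u w : List ℤ} (h : ∀ z ∈ u, ∀ x ∈ w, z ≤ x) (r : List ℤ) :
    bumpWord (u ++ r) w = ((bumpWord r w).1, u ++ (bumpWord r w).2) := by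
  induction w generalizing r with
  | nil => rfl
  | cons x w ih =>
    rw [bumpWord, bump_append_of_forall_le fun z hz => h z hz x (by simp), bumpWord,
      ih fun z hz y hy => h z hz y (by simp [hy])]

theorem bump_bump_of_le {y z u : ℤ} (hyz : y ≤ z) : ∀ {r : List ℤ}, r.Pairwise (· ≤ ·) →
    (bump z (bump y r).2).1 = some u → ∃ v, (bump y r).1 = some v ∧ v ≤ u
  | [], _, h => by simp [bump, not_lt.2 hyz] at h
  | a :: r, hr, h => by
    rw [List.pairwise_cons] at hr
    by_cases hya : y < a
    · simp only [bump, hya, if_true, not_lt.2 hyz, if_false] at h ⊢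
      exact ⟨a, rfl, hr.1 _ (mem_of_bump_eq_some h)⟩
    · have hza : ¬ z < a := by omega
      simp only [bump, hya, if_false, hza] at h ⊢
      exact bump_bump_of_le hyz hr.2 h

theorem bump_bump_of_lt {y z : ℤ} (hyz : y < z) : ∀ {r : List ℤ}, r.Pairwise (· ≤ ·) →
    ∃ v, (bump y (bump z r).2).1 = some v ∧ v ≤ z
  | [], _ => by simp [bump, hyz]
  | a :: r, hr => by
    rw [List.pairwise_cons] at hr
    by_cases hza : z < a
    · simp [bump, hza, hyz]
    · by_cases hya : y < a
      · simp [bump, hza, hya, not_lt.1 hza]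
      · simp only [bump, hya, if_false, hza]
        exact bump_bump_of_lt hyz hr.2

theorem bumpWord_yzx_cons {x y z a : ℤ} {r : List ℤ} (hxy : x < y) (hyz : y ≤ z) (hxa : x < a)
    (hr : (a :: r).Pairwise (· ≤ ·)) :
    (bumpWord (a :: r) [y, z, x]).2 = (bumpWord (a :: r) [y, x, z]).2 ∧
      Relation.ReflGen KnuthStep (bumpWord (a :: r) [y, z, x]).1
        (bumpWord (a :: r) [y, x, z]).1 := by
  rw [List.pairwise_cons] at hr
  have hzx : ¬ z < x := by omega
  by_cases hya : y < a
  · simp only [bumpWord, bump, hya, if_true, not_lt.2 hyz, if_false, hxy, hzx, true_and,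
      Option.toList, List.append_nil]
    cases hz : (bump z r).1 with
    | none => exact .refl
    | some u => exact .single (.yzx hya (hr.1 u (mem_of_bump_eq_some hz)))
  · have hza : ¬ z < a := by omega
    simp only [bumpWord, bump, hya, if_false, hza, hxa, if_true, hzx, true_and, Option.toList,
      List.append_nil]
    cases hz : (bump z (bump y r).2).1 with
    | none => simpa using .refl
    | some u =>
      obtain ⟨v, hv, hvu⟩ := bump_bump_of_le hyz hr.2 hz
      rw [hv]
      exact .single (.yzx ((not_lt.1 hya).trans_lt (lt_of_bump hv)) hvu)

theorem bumpWord_xzy_cons {x y z a : ℤ} {r : List ℤ} (hxy : x ≤ y) (hyz : y < z) (hxa : x < a)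
    (hr : (a :: r).Pairwise (· ≤ ·)) :
    (bumpWord (a :: r) [x, z, y]).2 = (bumpWord (a :: r) [z, x, y]).2 ∧
      Relation.ReflGen KnuthStep (bumpWord (a :: r) [x, z, y]).1
        (bumpWord (a :: r) [z, x, y]).1 := by
  rw [List.pairwise_cons] at hr
  have hxz : x < z := by omega
  by_cases hza : z < a
  · simp only [bumpWord, bump, hxa, if_true, not_lt.2 hxz.le, hza, if_false, hxz, not_lt.2 hxy,
      Option.toList, List.append_nil]
    cases r with
    | nil => simpa [bump, hyz] using .refl
    | cons c r =>
      have hac := hr.1 c (by simp)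
      simp only [bump, hza.trans_le hac, if_true, hyz, (hyz.trans hza).trans_le hac, true_and]
      exact .single (.yzx hza hac)
  · simp only [bumpWord, bump, hxa, if_true, not_lt.2 hxz.le, if_false, hza, not_lt.2 hxy,
      true_and, Option.toList, List.append_nil]
    cases hz : (bump z r).1 with
    | none => simpa using .refl
    | some u =>
      obtain ⟨v, hv, hvz⟩ := bump_bump_of_lt hyz hr.2
      rw [hv]
      refine .single (.xzy ?_ (hvz.trans_lt (lt_of_bump hz)))
      rcases mem_bump (mem_of_bump_eq_some hv) with rfl | hmem
      · exact not_lt.1 hza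
      · exact hr.1 v hmem

/-- A prefix of letters that do not exceed `x`, the smallest letter of `v`, plays no role. -/
theorem KnuthStep.bumpWord {v w r : List ℤ} (h : KnuthStep v w) (hr : r.Pairwise (· ≤ ·)) :
    (bumpWord r v).2 = (bumpWord r w).2 ∧
      Relation.ReflGen KnuthStep (bumpWord r v).1 (bumpWord r w).1 := by
  cases h with
  | @yzx x y z hxy hyz =>
    rcases bump_cases x r with ⟨-, hu⟩ | ⟨u, a, s, rfl, hu, hxa, -⟩
    · rw [← List.append_nil r, bumpWord_append_of_forall_le (by grind),
        bumpWord_append_of_forall_le (by grind)]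
      simpa [FactorSeq.bumpWord, bump, hxy, not_lt.2 hyz, not_lt.2 (hxy.le.trans hyz)] using .refl
    · rw [bumpWord_append_of_forall_le (by grind), bumpWord_append_of_forall_le (by grind)]
      simpa using bumpWord_yzx_cons hxy hyz hxa (List.pairwise_append.1 hr).2.1
  | @xzy x y z hxy hyz =>
    rcases bump_cases x r with ⟨-, hu⟩ | ⟨u, a, s, rfl, hu, hxa, -⟩
    · rw [← List.append_nil r, bumpWord_append_of_forall_le (by grind),
        bumpWord_append_of_forall_le (by grind)]
      simpa [FactorSeq.bumpWord, bump, hyz, not_lt.2 hxy, hxy.trans_lt hyz,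
        not_lt.2 (hxy.trans hyz.le)] using .refl
    · rw [bumpWord_append_of_forall_le (by grind), bumpWord_append_of_forall_le (by grind)]
      simpa using bumpWord_xzy_cons hxy hyz hxa (List.pairwise_append.1 hr).2.1

theorem insertWord_append (rs : List (List ℤ)) (v w : List ℤ) :
    insertWord rs (v ++ w) = insertWord (insertWord rs v) w := List.foldl_append

theorem insertWord_cons (r : List ℤ) (rs : List (List ℤ)) (w : List ℤ) :
    insertWord (r :: rs) w = (bumpWord r w).2 :: insertWord rs (bumpWord r w).1 := by
  induction w generalizing r rs with
  | nil => rfl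
  | cons x w ih =>
    cases h : (bump x r).1 <;>
      simp only [insertWord, List.foldl_cons, insertRows, bumpWord, h, Option.toList] <;>
      exact ih _ _

theorem insertWord_of_ne_nil (rs : List (List ℤ)) {w : List ℤ} (hw : w ≠ []) :
    insertWord rs w = (bumpWord (rs.headD []) w).2 ::
      insertWord rs.tail (bumpWord (rs.headD []) w).1 := by
  cases rs with
  | nil =>
    obtain ⟨x, w, rfl⟩ := List.exists_cons_of_ne_nil hw
    simpa [bumpWord, bump, insertWord, insertRows] using insertWord_cons [x] [] w
  | cons r rs => exact insertWord_cons r rs w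

theorem IsTableau.insertWord {rs : List (List ℤ)} (h : IsTableau rs) (w : List ℤ) :
    IsTableau (insertWord rs w) := by
  induction w generalizing rs with
  | nil => exact h
  | cons x _ ih => exact ih (h.insertRows x)

theorem KnuthStep.insertWord_eq : ∀ {rs : List (List ℤ)} {v w : List ℤ}, KnuthStep v w →
    (∀ r ∈ rs, r.Pairwise (· ≤ ·)) → insertWord rs v = insertWord rs w
  | [], _, _, .yzx hxy hyz, _ => by
    simp [insertWord, insertRows, bump, hxy, not_lt.2 hyz, not_lt.2 (hxy.le.trans hyz)]
  | [], _, _, .xzy hxy hyz, _ => by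
    simp [insertWord, insertRows, bump, hyz, not_lt.2 hxy, hxy.trans_lt hyz,
      not_lt.2 (hxy.trans hyz.le)]
  | r :: rs, v, w, h, hr => by
    rw [List.forall_mem_cons] at hr
    obtain ⟨hrow, hbumped⟩ := h.bumpWord hr.1
    rw [insertWord_cons, insertWord_cons, hrow]
    rcases (Relation.reflGen_iff _ _ _).1 hbumped with heq | hstep
    · rw [heq]
    · rw [hstep.insertWord_eq hr.2]

theorem KnuthEq.insertWord_eq {v w : List ℤ} (h : KnuthEq v w) {rs : List (List ℤ)}
    (hr : IsTableau rs) : insertWord rs v = insertWord rs w := by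
  induction h generalizing rs with
  | refl => rfl
  | symm _ ih => exact (ih hr).symm
  | trans _ _ ih₁ ih₂ => exact (ih₁ hr).trans (ih₂ hr)
  | append p s _ ih => simp only [insertWord_append, ih (hr.insertWord p)]
  | of_step h => exact h.insertWord_eq hr.row_weak

theorem knuthEq_append_singleton {a x : ℤ} {r : List ℤ} (hr : (a :: r).Pairwise (· ≤ ·))
    (hx : x < a) : KnuthEq (a :: r ++ [x]) (a :: x :: r) := by
  induction r generalizing a with
  | nil => exact .refl _
  | cons c r ih =>
    have hac := (List.pairwise_cons.1 hr).1 c (by simp)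
    exact ((ih (List.pairwise_cons.1 hr).2 (hx.trans_le hac)).cons a).trans
      ((KnuthEq.of_step (.yzx hx hac)).append_right r)

theorem knuthEq_cons_append {a x : ℤ} {u : List ℤ} (hu : u.Pairwise (· ≤ ·))
    (hux : ∀ y ∈ u, y ≤ x) (hx : x < a) : KnuthEq (u ++ [a, x]) (a :: u ++ [x]) := by
  induction u with
  | nil => exact .refl _
  | cons c u ih =>
    rw [List.pairwise_cons] at hu
    rw [List.forall_mem_cons] at hux
    refine ((ih hu.2 hux.2).cons c).trans ?_
    cases u with
    | nil => exact .of_step (.xzy hux.1 hx)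
    | cons d u =>
      exact (KnuthEq.of_step
        (.xzy (hu.1 d (by simp)) ((hux.2 d (by simp)).trans_lt hx))).append_right (u ++ [x])

theorem knuthEq_bump {x : ℤ} {r : List ℤ} (hr : r.Pairwise (· ≤ ·)) :
    KnuthEq (r ++ [x]) ((bump x r).1.toList ++ (bump x r).2) := by
  rcases bump_cases x r with ⟨hb, -⟩ | ⟨u, a, s, rfl, hu, hxa, hb⟩ <;> rw [hb]
  · exact .refl _
  · rw [List.pairwise_append] at hr
    simpa using ((knuthEq_append_singleton hr.2.1 hxa).append_left u).trans
      (by simpa using (knuthEq_cons_append hr.1 hu hxa).append_right s)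

theorem knuthEq_insertRows : ∀ {rs : List (List ℤ)} {x : ℤ}, (∀ r ∈ rs, r.Pairwise (· ≤ ·)) →
    KnuthEq (rs.reverse.flatten ++ [x]) (insertRows rs x).reverse.flatten
  | [], _, _ => by simpa [insertRows] using .refl _
  | r :: rs, x, hr => by
    rw [List.forall_mem_cons] at hr
    have h := (knuthEq_bump (x := x) hr.1).append_left rs.reverse.flatten
    cases hb : (bump x r).1 with
    | none => simpa [insertRows, hb] using h
    | some y =>
      simp only [insertRows, hb, List.reverse_cons, List.flatten_append, List.flatten_singleton,
        List.append_assoc]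
      rw [hb] at h
      exact h.trans (by simpa using
        (knuthEq_insertRows (x := y) hr.2).append_right (bump x r).2)

theorem knuthEq_insertWord {rs : List (List ℤ)} (hr : IsTableau rs) (w : List ℤ) :
    KnuthEq (rs.reverse.flatten ++ w) (insertWord rs w).reverse.flatten := by
  induction w generalizing rs with
  | nil => simpa using .refl _
  | cons x w ih =>
    have h := (knuthEq_insertRows (x := x) hr.row_weak).append_right w
    exact (by simpa using h : KnuthEq _ _).trans (ih (hr.insertRows x))

namespace Tableau

theorem rows_mul (P Q : Tableau) : (P * Q).rows = insertWord P.rows Q.word := by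
  change (Q.word.foldl insert P).rows = _
  induction Q.word generalizing P with
  | nil => rfl
  | cons x _ ih => exact ih _

theorem knuthEq_word_mul (P Q : Tableau) : KnuthEq (P.word ++ Q.word) (P * Q).word := by
  unfold word
  rw [rows_mul]
  exact knuthEq_insertWord P.isTableau _

instance : Semigroup Tableau where
  mul_assoc P Q R := by
    ext1
    rw [rows_mul, rows_mul, rows_mul, ← insertWord_append]
    exact (Q.knuthEq_word_mul R).insertWord_eq P.isTableau

end Tableau

end Knuth

/-! ### Rows of tableaux, padded by empty rows -/

section Rows

instance : IsTrans (List ℤ) Above := ⟨fun _ _ _ => Above.trans⟩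

theorem above_nil (r : List ℤ) : Above r [] := by
  cases r <;> trivial

theorem Above.length_le : ∀ {r s : List ℤ}, Above r s → s.length ≤ r.length
  | _, [], _ => by simp
  | [], _ :: _, h => h.elim
  | _ :: _, _ :: _, h => by simpa using h.2.length_le

theorem Above.exists_lt : ∀ {r s : List ℤ}, Above r s → ∀ y ∈ s, ∃ x ∈ r, x < y
  | _, [], _ => by simp
  | [], _ :: _, h => h.elim
  | a :: r, b :: s, h => by
    rw [List.forall_mem_cons]
    exact ⟨⟨a, by simp, h.1⟩, fun y hy => (h.2.exists_lt y hy).imp fun x hx => by simp [hx]⟩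

theorem Above.append : ∀ {r s r' s' : List ℤ}, Above r s → Above r' s' →
    (r.length = s.length ∨ s' = []) → Above (r ++ r') (s ++ s')
  | [], [], _, _, _, h', _ => h'
  | _ :: _, [], _, _, _, _, hl => by
    obtain rfl := hl.resolve_left (by simp)
    exact above_nil _
  | [], _ :: _, _, _, h, _, _ => h.elim
  | _ :: _, _ :: _, _, _, h, h', hl => ⟨h.1, h.2.append h' (by simpa using hl)⟩

theorem above_of_forall_lt : ∀ {r s : List ℤ}, s.length ≤ r.length →
    (∀ x ∈ r, ∀ y ∈ s, x < y) → Above r s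
  | _, [], _, _ => above_nil _
  | [], _ :: _, h, _ => by simp at h
  | a :: r, b :: s, h, hlt => ⟨hlt a (by simp) b (by simp),
      above_of_forall_lt (by simpa using h) fun x hx y hy => hlt x (by simp [hx]) y (by simp [hy])⟩

theorem getD_filter_of_pairwise_above : ∀ {l : List (List ℤ)}, l.Pairwise Above → ∀ i,
    (l.filter (fun r => !r.isEmpty)).getD i [] = l.getD i []
  | [], _, _ => rfl
  | [] :: l, h, i => by
    have hnil : ∀ s ∈ [] :: l, s = [] := List.forall_mem_cons.2 ⟨rfl, fun s hs => by
      simpa using ((List.pairwise_cons.1 h).1 s hs).length_le⟩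
    rw [List.filter_eq_nil_iff.2 fun s hs => by simp [hnil s hs], List.eq_replicate_of_mem hnil]
    simp only [List.getD_eq_getElem?_getD, List.getElem?_replicate]
    split_ifs <;> rfl
  | (_ :: _) :: _, _, 0 => by simp
  | (_ :: _) :: _, h, i + 1 => by
    simpa using getD_filter_of_pairwise_above (List.pairwise_cons.1 h).2 i

theorem isChain_above_iff {l : List (List ℤ)} :
    l.IsChain Above ↔ ∀ i, Above (l.getD i []) (l.getD (i + 1) []) := by
  induction l with
  | nil => simp [above_nil]
  | cons r l ih =>
    rw [List.isChain_cons, ih]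
    refine Iff.trans (and_congr_left' ?_) (Nat.and_forall_add_one
      (p := fun i => Above ((r :: l).getD i []) ((r :: l).getD (i + 1) [])))
    cases l <;> simp [above_nil]

theorem getD_mem_or_eq_nil (l : List (List ℤ)) (i : ℕ) : l.getD i [] ∈ l ∨ l.getD i [] = [] := by
  rw [List.getD_eq_getElem?_getD]
  cases hk : l[i]? with
  | none => exact .inr rfl
  | some s => exact .inl (List.mem_of_getElem? hk)

namespace Tableau

/-- The `i`-th row (numbered from `0`), which is empty if there is no such row. -/
def row (T : Tableau) (i : ℕ) : List ℤ := T.rows.getD i []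

theorem row_sorted (T : Tableau) (i : ℕ) : (T.row i).Pairwise (· ≤ ·) := by
  rcases getD_mem_or_eq_nil T.rows i with h | h
  · exact T.isTableau.row_weak _ h
  · rw [row, h]
    exact .nil

theorem row_above (T : Tableau) (i : ℕ) : Above (T.row i) (T.row (i + 1)) :=
  isChain_above_iff.1 T.isTableau.col_strict i

theorem row_above_of_lt (T : Tableau) {i j : ℕ} (h : i < j) : Above (T.row i) (T.row j) :=
  Nat.rel_of_forall_rel_succ_of_lt Above T.row_above h

theorem row_eq_nil {T : Tableau} {i : ℕ} (h : T.rows.length ≤ i) : T.row i = [] :=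
  List.getD_eq_default _ _ h

theorem row_ne_nil {T : Tableau} {i : ℕ} (h : i < T.rows.length) : T.row i ≠ [] := by
  rw [row, List.getD_eq_getElem _ _ h]
  exact T.isTableau.ne_nil _ (List.getElem_mem h)

theorem row_ext {A B : Tableau} (h : ∀ i, A.row i = B.row i) : A = B := by
  have hl : A.rows.length = B.rows.length := by
    rcases lt_trichotomy A.rows.length B.rows.length with hl | hl | hl
    · exact absurd ((h _).symm.trans (row_eq_nil le_rfl)) (row_ne_nil hl)
    · exact hl
    · exact absurd ((h _).trans (row_eq_nil le_rfl)) (row_ne_nil hl)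
  ext1
  refine List.ext_getElem hl fun i h₁ h₂ => ?_
  simpa only [row, List.getD_eq_getElem _ _ h₁, List.getD_eq_getElem _ _ h₂] using h i

theorem hasEntry_iff_row {T : Tableau} {x : ℤ} : T.HasEntry x ↔ ∃ i, x ∈ T.row i := by
  constructor
  · rintro ⟨r, hr, hx⟩
    obtain ⟨i, hi, rfl⟩ := List.getElem_of_mem hr
    exact ⟨i, by rwa [row, List.getD_eq_getElem _ _ hi]⟩
  · rintro ⟨i, hx⟩
    rcases getD_mem_or_eq_nil T.rows i with h | h
    · exact ⟨_, h, hx⟩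
    · rw [row, h] at hx
      simp at hx

@[simp] theorem row_empty (i : ℕ) : (∅ : Tableau).row i = [] := row_eq_nil (Nat.zero_le _)

theorem row_left (b : ℕ) (T : Tableau) (i : ℕ) : (T.left b).row i = (T.row i).take b := by
  unfold row left
  rw [getD_filter_of_pairwise_above
    (List.pairwise_map.2 (T.isTableau.pairwise.imp fun h => h.take b))]
  simp only [List.getD_eq_getElem?_getD, List.getElem?_map]
  cases T.rows[i]? <;> simp

theorem row_right (b : ℕ) (T : Tableau) (i : ℕ) : (T.right b).row i = (T.row i).drop b := by
  unfold row right
  rw [getD_filter_of_pairwise_above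
    (List.pairwise_map.2 (T.isTableau.pairwise.imp fun h => h.drop b))]
  simp only [List.getD_eq_getElem?_getD, List.getElem?_map]
  cases T.rows[i]? <;> simp

theorem row_top (a : ℕ) (T : Tableau) (i : ℕ) :
    (T.top a).row i = if i < a then T.row i else [] := by
  simp only [row, top, List.getD_eq_getElem?_getD, List.getElem?_take]
  split_ifs <;> simp

theorem row_below (a : ℕ) (T : Tableau) (i : ℕ) : (T.below a).row i = T.row (a + i) := by
  simp [row, below, List.getD_eq_getElem?_getD, List.getElem?_drop]

theorem row_length_antitone (T : Tableau) : Antitone fun i => (T.row i).length :=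
  antitone_nat_of_succ_le fun i => (T.row_above i).length_le

theorem exists_le_of_mem_row (T : Tableau) {i j : ℕ} (h : i ≤ j) {y : ℤ} (hy : y ∈ T.row j) :
    ∃ x ∈ T.row i, x ≤ y := by
  rcases h.eq_or_lt with rfl | h
  · exact ⟨y, hy, le_rfl⟩
  · exact ((T.row_above_of_lt h).exists_lt y hy).imp fun x hx => ⟨hx.1, hx.2.le⟩

theorem le_of_mem_take_of_mem_drop (T : Tableau) {b i : ℕ} {x y : ℤ} (hx : x ∈ (T.row i).take b)
    (hy : y ∈ (T.row i).drop b) : x ≤ y := by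
  have h := T.row_sorted i
  rw [← List.take_append_drop b (T.row i), List.pairwise_append] at h
  exact h.2.2 x hx y hy

theorem below_left (a b : ℕ) (T : Tableau) : (T.below a).left b = (T.left b).below a :=
  row_ext fun i => by simp only [row_left, row_below]

theorem below_right (a b : ℕ) (T : Tableau) : (T.below a).right b = (T.right b).below a :=
  row_ext fun i => by simp only [row_right, row_below]

theorem top_left (a b : ℕ) (T : Tableau) : (T.top a).left b = (T.left b).top a :=
  row_ext fun i => by
    simp only [row_left, row_top]
    split_ifs <;> simp

theorem top_right (a b : ℕ) (T : Tableau) : (T.top a).right b = (T.right b).top a :=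
  row_ext fun i => by
    simp only [row_right, row_top]
    split_ifs <;> simp

theorem left_left {b c : ℕ} (h : b ≤ c) (X : Tableau) : (X.left c).left b = X.left b :=
  row_ext fun i => by simp only [row_left, List.take_take, min_eq_left h]

theorem right_left (b c : ℕ) (X : Tableau) :
    (X.right b).left (c - b) = (X.left c).right b :=
  row_ext fun i => by simp only [row_left, row_right, List.drop_take]

theorem right_right (b c : ℕ) (X : Tableau) : (X.right b).right c = X.right (b + c) :=
  row_ext fun i => by simp only [row_right, List.drop_drop]

end Tableau

end Rows

/-! ### Products of tableaux that fit together -/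

section Fitting

theorem bumpWord_of_above : ∀ {r s v : List ℤ}, r.Pairwise (· ≤ ·) → Above r s →
    (r.length = s.length ∨ v = []) → bumpWord (s ++ v) r = (s, r ++ v)
  | [], s, _, _, h, _ => by simp [bumpWord, List.length_eq_zero_iff.1 (Nat.le_zero.1 h.length_le)]
  | x :: r, s, v, hr, h, hv => by
    rw [List.pairwise_cons] at hr
    have hx : ∀ z ∈ [x], ∀ y ∈ r, z ≤ y := by simpa using hr.1
    cases s with
    | nil =>
      obtain rfl := hv.resolve_left (by simp)
      have hcons := bumpWord_append_of_forall_le hx []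
      have ih := bumpWord_of_above (v := []) hr.2 (above_nil r) (.inr rfl)
      simp_all [bumpWord, bump]
    | cons y s =>
      have hcons := bumpWord_append_of_forall_le hx (s ++ v)
      simp_all [bumpWord, bump, h.1, bumpWord_of_above hr.2 h.2 (v := v) (by simpa using hv)]

/-- Append the rows of `rs` to the rows of `ls`. -/
def zipAppend : List (List ℤ) → List (List ℤ) → List (List ℤ)
  | ls, [] => ls
  | ls, r :: rs => (ls.headD [] ++ r) :: zipAppend ls.tail rs

theorem getD_zipAppend : ∀ (ls rs : List (List ℤ)) (i : ℕ),
    (zipAppend ls rs).getD i [] = ls.getD i [] ++ rs.getD i []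
  | _, [], _ => by simp [zipAppend]
  | [], _ :: _, 0 => rfl
  | _ :: _, _ :: _, 0 => rfl
  | [], _ :: rs, i + 1 => by simpa [zipAppend] using getD_zipAppend [] rs i
  | _ :: ls, _ :: rs, i + 1 => by simpa [zipAppend] using getD_zipAppend ls rs i

theorem insertWord_zipAppend {ls rs : List (List ℤ)} {r : List ℤ} (h : IsTableau (r :: rs))
    (hle : ∀ i j, i ≤ j → ∀ x ∈ ls.getD i [], ∀ y ∈ (r :: rs).getD j [], x ≤ y) :
    insertWord (zipAppend ls rs) r = zipAppend ls (r :: rs) := by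
  have hr : ∀ x ∈ ls.headD [], ∀ y ∈ r, x ≤ y := by
    simpa only [List.headD_eq_getD, List.getD_cons_zero] using hle 0 0 le_rfl
  have hsorted := h.row_weak r (by simp)
  induction rs generalizing ls r with
  | nil =>
    have happend := bumpWord_append_of_forall_le hr []
    have hnew := bumpWord_of_above (v := []) hsorted (above_nil r) (.inr rfl)
    rw [List.append_nil, List.append_nil] at hnew
    rw [hnew, List.append_nil] at happend
    rw [zipAppend, insertWord_of_ne_nil _ (h.ne_nil r (by simp)), happend]
    rfl
  | cons s rs ih =>
    have hls : ∀ i j, i ≤ j → ∀ x ∈ ls.tail.getD i [], ∀ y ∈ (s :: rs).getD j [], x ≤ y :=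
      fun i j hij => by
        have := hle (i + 1) (j + 1) (by omega)
        cases ls <;> simp_all
    have hs : ∀ x ∈ ls.tail.headD [], ∀ y ∈ s, x ≤ y := by
      simpa only [List.headD_eq_getD, List.getD_cons_zero] using hls 0 0 le_rfl
    have hrs := bumpWord_of_above (v := []) hsorted (List.isChain_cons_cons.1 h.col_strict).1
      (.inr rfl)
    rw [List.append_nil, List.append_nil] at hrs
    rw [zipAppend, insertWord_cons, bumpWord_append_of_forall_le hr, hrs,
      ih h.tail hls hs (h.row_weak s (by simp))]
    rfl

theorem insertWord_flatten_reverse {ls rs : List (List ℤ)} (h : IsTableau rs)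
    (hle : ∀ i j, i ≤ j → ∀ x ∈ ls.getD i [], ∀ y ∈ rs.getD j [], x ≤ y) :
    insertWord ls rs.reverse.flatten = zipAppend ls rs := by
  induction rs with
  | nil => rfl
  | cons r rs ih =>
    rw [List.reverse_cons, List.flatten_append, insertWord_append,
      ih h.tail fun i j hij => by simpa using hle i (j + 1) (by omega), List.flatten_singleton]
    exact insertWord_zipAppend h hle

namespace Tableau

theorem rows_mul_of_le {A B : Tableau} (h : ∀ i, ∀ x ∈ A.row i, ∀ y ∈ B.row i, x ≤ y) :
    (A * B).rows = zipAppend A.rows B.rows := by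
  rw [rows_mul]
  refine insertWord_flatten_reverse B.isTableau fun i j hij x hx y hy => ?_
  obtain ⟨z, hz, hzy⟩ := B.exists_le_of_mem_row hij hy
  exact (h i x hx z hz).trans hzy

theorem row_mul_of_le {A B : Tableau} (h : ∀ i, ∀ x ∈ A.row i, ∀ y ∈ B.row i, x ≤ y) (i : ℕ) :
    (A * B).row i = A.row i ++ B.row i := by
  rw [row, rows_mul_of_le h, getD_zipAppend]
  rfl

@[simp] protected theorem empty_mul (T : Tableau) : ∅ * T = T :=
  row_ext fun i => by rw [row_mul_of_le] <;> simp

@[simp] protected theorem mul_empty (T : Tableau) : T * ∅ = T := rfl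

theorem eq_of_knuthEq_word {A B : Tableau} (h : KnuthEq A.word B.word) : A = B := by
  rw [← A.empty_mul, ← B.empty_mul]
  ext1
  rw [rows_mul, rows_mul, h.insertWord_eq (∅ : Tableau).isTableau]

theorem rows_mul_of_isTableau {A B : Tableau} (h : IsTableau (A.rows ++ B.rows)) :
    (B * A).rows = A.rows ++ B.rows := by
  have hBA : B * A = ⟨A.rows ++ B.rows, h⟩ := eq_of_knuthEq_word <| by
    simpa [word] using (B.knuthEq_word_mul A).symm
  rw [hBA]

theorem below_mul_top (a : ℕ) (T : Tableau) : T.below a * T.top a = T := by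
  ext1
  have : (T.top a).rows ++ (T.below a).rows = T.rows := List.take_append_drop a T.rows
  rw [rows_mul_of_isTableau (by rw [this]; exact T.isTableau), this]

theorem left_mul_right (b : ℕ) (T : Tableau) : T.left b * T.right b = T := by
  refine row_ext fun i => ?_
  rw [row_mul_of_le, row_left, row_right, List.take_append_drop]
  intro i x hx y hy
  rw [row_left] at hx
  rw [row_right] at hy
  exact T.le_of_mem_take_of_mem_drop hx hy

theorem right_eq_mul {b c : ℕ} (h : b ≤ c) (X : Tableau) :
    X.right b = (X.left c).right b * X.right c := by
  conv_lhs => rw [← left_mul_right (c - b) (X.right b)]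
  rw [right_left, right_right, Nat.add_sub_cancel' h]

theorem hasEntry_iff_mem_word {T : Tableau} {x : ℤ} : T.HasEntry x ↔ x ∈ T.word := by
  simp [HasEntry, word, List.mem_flatten]

theorem hasEntry_mul {P Q : Tableau} {x : ℤ} :
    (P * Q).HasEntry x ↔ P.HasEntry x ∨ Q.HasEntry x := by
  simp only [hasEntry_iff_mem_word]
  rw [← (P.knuthEq_word_mul Q).perm.mem_iff, List.mem_append]

theorem length_word_mul (P Q : Tableau) :
    (P * Q).word.length = P.word.length + Q.word.length := by
  rw [← (P.knuthEq_word_mul Q).perm.length_eq, List.length_append]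

theorem eq_empty_of_forall_not_hasEntry {T : Tableau} (h : ∀ x, ¬ T.HasEntry x) : T = ∅ := by
  refine row_ext fun i => ?_
  rw [row_empty, List.eq_nil_iff_forall_not_mem]
  exact fun x hx => h x (hasEntry_iff_row.2 ⟨i, hx⟩)

theorem HasEntry.of_left {b : ℕ} {T : Tableau} {x : ℤ} (h : (T.left b).HasEntry x) :
    T.HasEntry x := by
  rw [← left_mul_right b T, hasEntry_mul]
  exact .inl h

theorem HasEntry.of_right {b : ℕ} {T : Tableau} {x : ℤ} (h : (T.right b).HasEntry x) :
    T.HasEntry x := by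
  rw [← left_mul_right b T, hasEntry_mul]
  exact .inr h

theorem HasEntry.of_top {a : ℕ} {T : Tableau} {x : ℤ} (h : (T.top a).HasEntry x) :
    T.HasEntry x := by
  rw [← below_mul_top a T, hasEntry_mul]
  exact .inr h

theorem HasEntry.of_below {a : ℕ} {T : Tableau} {x : ℤ} (h : (T.below a).HasEntry x) :
    T.HasEntry x := by
  rw [← below_mul_top a T, hasEntry_mul]
  exact .inl h

/-- `A` has at most `b` columns and can be placed to the left of `B` so that the rows of `B`
start in column `b`. -/
structure FitsLeft (b : ℕ) (A B : Tableau) : Prop where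
  length_le : ∀ i, (A.row i).length ≤ b
  le_length : ∀ i, ∀ y ∈ B.row i, b ≤ (A.row i).length
  le : ∀ i, ∀ x ∈ A.row i, ∀ y ∈ B.row i, x ≤ y

theorem fitsLeft_left_right (b : ℕ) (T : Tableau) : FitsLeft b (T.left b) (T.right b) where
  length_le i := by
    rw [row_left]
    exact List.length_take_le _ _
  le_length i y hy := by
    rw [row_right] at hy
    have := List.length_pos_of_mem hy
    rw [List.length_drop] at this
    rw [row_left, List.length_take]
    omega
  le i x hx y hy := by
    rw [row_left] at hx
    rw [row_right] at hy
    exact T.le_of_mem_take_of_mem_drop hx hy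

theorem FitsLeft.mono {b : ℕ} {A B C : Tableau} (h : FitsLeft b A B)
    (hC : ∀ i, ∀ y ∈ C.row i, ∃ x ∈ B.row i, x ≤ y) : FitsLeft b A C where
  length_le := h.length_le
  le_length i y hy :=
    let ⟨x, hx, _⟩ := hC i y hy
    h.le_length i x hx
  le i z hz y hy :=
    let ⟨x, hx, hxy⟩ := hC i y hy
    (h.le i z hz x hx).trans hxy

theorem FitsLeft.left_mul {b : ℕ} {A B : Tableau} (h : FitsLeft b A B) : (A * B).left b = A := by
  refine row_ext fun i => ?_
  rw [row_left, row_mul_of_le h.le]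
  cases hB : B.row i with
  | nil => rw [List.append_nil, List.take_of_length_le (h.length_le i)]
  | cons y r =>
    exact List.take_left' (le_antisymm (h.length_le i) (h.le_length i y (by simp [hB])))

theorem FitsLeft.right_mul {b : ℕ} {A B : Tableau} (h : FitsLeft b A B) :
    (A * B).right b = B := by
  refine row_ext fun i => ?_
  rw [row_right, row_mul_of_le h.le]
  cases hB : B.row i with
  | nil => rw [List.append_nil, List.drop_eq_nil_of_le (h.length_le i)]
  | cons y r =>
    exact List.drop_left' (le_antisymm (h.length_le i) (h.le_length i y (by simp [hB])))

end Tableau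

end Fitting

/-! ### Right factors that leave the first columns alone -/

section Columns

/-- `Dominates r s`: the row `r` is at least as long as `s`, and its entries are at most the
corresponding entries of `s`. -/
def Dominates : List ℤ → List ℤ → Prop
  | _, [] => True
  | [], _ :: _ => False
  | x :: r, y :: s => x ≤ y ∧ Dominates r s

theorem dominates_nil (r : List ℤ) : Dominates r [] := by
  cases r <;> trivial

theorem Dominates.refl : ∀ r : List ℤ, Dominates r r
  | [] => trivial
  | _ :: r => ⟨le_rfl, .refl r⟩

theorem Dominates.trans : ∀ {r s t : List ℤ}, Dominates r s → Dominates s t → Dominates r t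
  | _, _, [], _, _ => dominates_nil _
  | _, [], _ :: _, _, h => h.elim
  | [], _ :: _, _ :: _, h, _ => h.elim
  | _ :: _, _ :: _, _ :: _, h, h' => ⟨h.1.trans h'.1, h.2.trans h'.2⟩

theorem Above.trans_dominates : ∀ {r s t : List ℤ}, Above r s → Dominates s t → Above r t
  | _, _, [], _, _ => above_nil _
  | _, [], _ :: _, _, h => h.elim
  | [], _ :: _, _ :: _, h, _ => h.elim
  | _ :: _, _ :: _, _ :: _, h, h' => ⟨h.1.trans_le h'.1, h.2.trans_dominates h'.2⟩

theorem dominates_iff_getElem? : ∀ {r s : List ℤ},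
    Dominates r s ↔ ∀ (i : ℕ), ∀ y ∈ s[i]?, ∃ x ∈ r[i]?, x ≤ y
  | _, [] => by simp [dominates_nil]
  | [], b :: s => by simpa [Dominates] using ⟨0, b, by simp⟩
  | a :: r, b :: s => by
    rw [Dominates, dominates_iff_getElem?, ← Nat.and_forall_add_one
      (p := fun i => ∀ y ∈ (b :: s)[i]?, ∃ x ∈ (a :: r)[i]?, x ≤ y)]
    simp

theorem Dominates.exists_le {r s : List ℤ} (h : Dominates r s) : ∀ y ∈ s, ∃ x ∈ r, x ≤ y := by
  intro y hy
  obtain ⟨i, hi⟩ := List.mem_iff_getElem?.1 hy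
  obtain ⟨x, hx, hxy⟩ := dominates_iff_getElem?.1 h i y hi
  exact ⟨x, List.mem_of_getElem? hx, hxy⟩

theorem Dominates.length_le : ∀ {r s : List ℤ}, Dominates r s → s.length ≤ r.length
  | _, [], _ => Nat.zero_le _
  | [], _ :: _, h => h.elim
  | _ :: _, _ :: _, h => Nat.succ_le_succ h.2.length_le

theorem dominates_bump (x : ℤ) : ∀ r : List ℤ, Dominates (bump x r).2 r
  | [] => dominates_nil _
  | y :: r => by
    by_cases h : x < y
    · simpa [bump, h, Dominates, h.le] using Dominates.refl r
    · simpa [bump, h, Dominates] using dominates_bump x r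

theorem Dominates.bump {x : ℤ} : ∀ {r s : List ℤ}, Dominates r s →
    Dominates (bump x r).2 (bump x s).2
  | [], [], _ => .refl _
  | [], _ :: _, h => h.elim
  | a :: r, [], _ => by
    by_cases h : x < a
    · simp [FactorSeq.bump, h, Dominates, dominates_nil]
    · simp [FactorSeq.bump, h, Dominates, dominates_nil, not_lt.1 h]
  | a :: r, b :: s, h => by
    have hab := h.1
    by_cases ha : x < a
    · simpa [FactorSeq.bump, ha, ha.trans_le hab, Dominates] using h.2
    · by_cases hb : x < b
      · simpa [FactorSeq.bump, ha, hb, Dominates, not_lt.1 ha] using (dominates_bump x r).trans h.2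
      · simpa [FactorSeq.bump, ha, hb, Dominates, hab] using h.2.bump

theorem Dominates.bumpWord {r s : List ℤ} (h : Dominates r s) (w : List ℤ) :
    Dominates (bumpWord r w).2 (bumpWord s w).2 := by
  induction w generalizing r s with
  | nil => exact h
  | cons _ _ ih => exact ih h.bump

theorem dominates_insertRows {x : ℤ} : ∀ (rs : List (List ℤ)) (i : ℕ),
    Dominates ((insertRows rs x).getD i []) (rs.getD i [])
  | [], _ => by simp [dominates_nil]
  | r :: rs, 0 => by cases h : (bump x r).1 <;> simpa [insertRows, h] using dominates_bump x r
  | r :: rs, i + 1 => by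
    cases h : (bump x r).1 with
    | none => simpa [insertRows, h] using Dominates.refl _
    | some y => simpa [insertRows, h] using dominates_insertRows rs i

theorem dominates_insertWord (rs : List (List ℤ)) (w : List ℤ) (i : ℕ) :
    Dominates ((insertWord rs w).getD i []) (rs.getD i []) := by
  induction w generalizing rs with
  | nil => exact .refl _
  | cons x _ ih => exact (ih (insertRows rs x)).trans (dominates_insertRows rs i)

/-- Column-insert `x` into a column: `x` replaces the topmost entry that is at least `x`, which is
bumped out; if there is none, `x` is put at the bottom of the column and nothing is bumped. -/
def colBump (x : ℤ) : List ℤ → Option ℤ × List ℤ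
  | [] => (none, [x])
  | y :: c => if x ≤ y then (some y, x :: c) else ((colBump x c).1, y :: (colBump x c).2)

theorem mem_colBump {x z : ℤ} : ∀ {c : List ℤ}, z ∈ (colBump x c).2 → z = x ∨ z ∈ c
  | [], h => by simpa [colBump] using h
  | y :: c, h => by
    by_cases hxy : x ≤ y
    · simp only [colBump, hxy, if_true, List.mem_cons] at h ⊢
      tauto
    · simp only [colBump, hxy, if_false, List.mem_cons] at h ⊢
      have := mem_colBump (x := x) (z := z) (c := c)
      tauto

theorem colBump_sorted {x : ℤ} : ∀ {c : List ℤ}, c.Pairwise (· < ·) →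
    (colBump x c).2.Pairwise (· < ·)
  | [], _ => by simp [colBump]
  | y :: c, h => by
    rw [List.pairwise_cons] at h
    by_cases hxy : x ≤ y
    · simp only [colBump, hxy, if_true, List.pairwise_cons]
      exact ⟨fun z hz => hxy.trans_lt (h.1 z hz), h.2⟩
    · simp only [colBump, hxy, if_false, List.pairwise_cons]
      refine ⟨fun z hz => ?_, colBump_sorted h.2⟩
      rcases mem_colBump hz with rfl | hz
      · exact not_le.1 hxy
      · exact h.1 z hz

theorem exists_colBump_eq_cons (x : ℤ) : ∀ c : List ℤ, ∃ y ≤ x, ∃ c', (colBump x c).2 = y :: c'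
  | [] => ⟨x, le_rfl, [], rfl⟩
  | y :: c => by
    by_cases hxy : x ≤ y
    · exact ⟨x, le_rfl, c, by simp [colBump, hxy]⟩
    · exact ⟨y, (not_le.1 hxy).le, (colBump x c).2, by simp [colBump, hxy]⟩

theorem le_of_colBump {x q : ℤ} : ∀ {c : List ℤ}, (colBump x c).1 = some q → x ≤ q
  | [], h => by simp [colBump] at h
  | z :: c, h => by
    by_cases hxz : x ≤ z
    · simp only [colBump, hxz, if_true, Option.some.injEq] at h
      exact h ▸ hxz
    · simp only [colBump, hxz, if_false] at h
      exact le_of_colBump h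

theorem dominates_colBump (x : ℤ) : ∀ c : List ℤ, Dominates (colBump x c).2 c
  | [] => dominates_nil _
  | y :: c => by
    by_cases h : x ≤ y
    · simpa [colBump, h, Dominates] using Dominates.refl c
    · simpa [colBump, h, Dominates] using dominates_colBump x c

theorem Dominates.colBump {p q : ℤ} : ∀ {c d : List ℤ}, Dominates c d →
    (colBump p c).1 = some q → Dominates (colBump p c).2 (colBump q d).2
  | [], _, _, h => by simp [FactorSeq.colBump] at h
  | u :: c, d, hcd, h => by
    by_cases hpu : p ≤ u
    · simp only [FactorSeq.colBump, hpu, if_true, Option.some.injEq] at h ⊢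
      subst h
      cases d with
      | nil => simp [FactorSeq.colBump, Dominates, hpu, dominates_nil]
      | cons v d => simpa [FactorSeq.colBump, Dominates, hcd.1, hpu] using hcd.2
    · simp only [FactorSeq.colBump, hpu, if_false] at h ⊢
      have huq : u ≤ q := (not_le.1 hpu).le.trans (le_of_colBump h)
      cases d with
      | nil => simp [FactorSeq.colBump, Dominates, huq, dominates_nil]
      | cons v d =>
        by_cases hqv : q ≤ v
        · simp only [FactorSeq.colBump, hqv, if_true]
          exact ⟨huq, (dominates_colBump p c).trans hcd.2⟩
        · simp only [FactorSeq.colBump, hqv, if_false]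
          exact ⟨hcd.1, hcd.2.colBump h⟩

theorem knuthEq_cons_reverse {p y : ℤ} (hpy : p ≤ y) : ∀ {c : List ℤ},
    (y :: c).Pairwise (· < ·) → KnuthEq (p :: (y :: c).reverse) ((p :: c).reverse ++ [y])
  | [], _ => .refl _
  | z :: c, h => by
    rw [List.pairwise_cons] at h
    have hyz := h.1 z (by simp)
    have hmove := (knuthEq_cons_reverse (hpy.trans hyz.le) h.2).append_right [y]
    have hstep := (KnuthEq.of_step (.xzy hpy hyz)).append_left c.reverse
    exact .trans (by simpa using hmove) (by simpa using hstep)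

theorem knuthEq_colBump {p : ℤ} : ∀ {c : List ℤ}, c.Pairwise (· < ·) →
    KnuthEq (p :: c.reverse) ((colBump p c).2.reverse ++ (colBump p c).1.toList)
  | [], _ => .refl _
  | y :: c, h => by
    by_cases hpy : p ≤ y
    · simpa [colBump, hpy] using knuthEq_cons_reverse hpy h
    · rw [List.pairwise_cons] at h
      have ih := (knuthEq_colBump (p := p) h.2).append_right [y]
      obtain ⟨e, hep, c', hc'⟩ := exists_colBump_eq_cons p c
      have hye : y < e := by
        rcases mem_colBump (hc' ▸ List.mem_cons_self : e ∈ (colBump p c).2) with rfl | he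
        exacts [not_le.1 hpy, h.1 e he]
      cases hq : (colBump p c).1 with
      | none => simpa [colBump, hpy, hq] using ih
      | some q =>
        have hstep := (KnuthEq.of_step (.yzx hye (hep.trans (le_of_colBump hq)))).append_left
          c'.reverse
        refine .trans (by simpa using ih) ?_
        simpa [colBump, hpy, hq, hc'] using hstep

namespace Tableau

theorem dominates_row_mul (M N : Tableau) (i : ℕ) : Dominates ((M * N).row i) (M.row i) := by
  rw [row, rows_mul]
  exact dominates_insertWord _ _ _

/-- Multiplying `X` by `N` from the right does not affect the first `b` columns of `X`. -/
def FixesCols (b : ℕ) (X N : Tableau) : Prop :=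
  (X * N).left b = X.left b ∧ (X * N).right b = X.right b * N

theorem fixesCols_of_right_eq {b : ℕ} {X M N : Tableau} (h : X.right b = M * N) :
    FixesCols b (X.left b * M) N := by
  have hX : X.left b * M * N = X := by rw [mul_assoc, ← h, left_mul_right]
  have hfits : FitsLeft b (X.left b) M := (fitsLeft_left_right b X).mono fun i =>
    (h ▸ dominates_row_mul M N i).exists_le
  exact ⟨by rw [hX, hfits.left_mul], by rw [hX, hfits.right_mul, h]⟩

theorem FixesCols.mono {b c : ℕ} (hbc : b ≤ c) {X N : Tableau} (h : FixesCols c X N) :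
    FixesCols b X N := by
  constructor
  · rw [← left_left hbc, h.1, left_left hbc]
  · rw [right_eq_mul hbc (X * N), h.1, h.2, ← mul_assoc, ← right_eq_mul hbc]

theorem FixesCols.right_one {b : ℕ} {X N : Tableau} (h : FixesCols (b + 1) X N) :
    FixesCols b (X.right 1) N := by
  have hone := (h.mono (b := 1) (by omega)).2
  have hleft (Y : Tableau) : (Y.right 1).left b = (Y.left (b + 1)).right 1 := right_left 1 (b + 1) Y
  constructor
  · rw [← hone, hleft, h.1, hleft]
  · rw [← hone, right_right, right_right, add_comm 1 b, h.2]

theorem fixesCols_succ {b : ℕ} {X N : Tableau} (hone : FixesCols 1 X N)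
    (h : FixesCols b (X.right 1) N) : FixesCols (b + 1) X N := by
  have htake (Y : Tableau) (i : ℕ) : (Y.row i).take (b + 1) =
      (Y.left 1).row i ++ ((Y.right 1).left b).row i := by
    rw [row_left, row_left, row_right, add_comm b 1, List.take_add]
  constructor
  · refine row_ext fun i => ?_
    rw [row_left, row_left, htake, htake, hone.1, hone.2, h.1]
  · rw [add_comm b 1, ← right_right, ← right_right, hone.2, h.2]

theorem fixesCols_zero (X N : Tableau) : FixesCols 0 X N := by
  have hright (Y : Tableau) : Y.right 0 = Y := row_ext fun i => by rw [row_right, List.drop_zero]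
  refine ⟨row_ext fun i => ?_, by rw [hright, hright]⟩
  rw [row_left, row_left, List.take_zero, List.take_zero]

/-- The tableau with a single box. -/
def single (p : ℤ) : Tableau := ⟨[[p]], by simp, by simp, by simp⟩

/-- The tableau with a single column. -/
def column (l : List ℤ) (hc : l.Pairwise (· < ·)) : Tableau where
  rows := l.map ([·])
  isTableau :=
    { ne_nil := by simp
      row_weak := by simp
      col_strict := (List.pairwise_map.2 (hc.imp fun h => ⟨h, trivial⟩)).isChain }

/-- The entries of the first column. -/
def col (T : Tableau) : List ℤ := T.rows.map List.headI

theorem getElem?_col (T : Tableau) (i : ℕ) : T.col[i]? = (T.row i).head? := by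
  rw [col, List.getElem?_map, row, List.getD_eq_getElem?_getD]
  cases h : T.rows[i]? with
  | none => rfl
  | some r =>
    obtain ⟨x, r, rfl⟩ := List.exists_cons_of_ne_nil
      (T.isTableau.ne_nil r (List.mem_of_getElem? h))
    rfl

theorem word_column {l : List ℤ} (hc : l.Pairwise (· < ·)) : (column l hc).word = l.reverse := by
  rw [word, column, ← List.map_reverse, ← List.flatMap_def, List.flatMap_singleton']

theorem row_column {l : List ℤ} (hc : l.Pairwise (· < ·)) (i : ℕ) :
    (column l hc).row i = l[i]?.toList := by
  rw [row, column, List.getD_eq_getElem?_getD, List.getElem?_map]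
  cases l[i]? <;> rfl

theorem col_column {l : List ℤ} (hc : l.Pairwise (· < ·)) : (column l hc).col = l := by
  rw [col, column, List.map_map]
  exact List.map_id _

theorem col_sorted (T : Tableau) : T.col.Pairwise (· < ·) := by
  refine List.pairwise_map.2 (T.isTableau.pairwise.imp_of_mem fun {r s} hr hs h => ?_)
  obtain ⟨x, r, rfl⟩ := List.exists_cons_of_ne_nil (T.isTableau.ne_nil r hr)
  obtain ⟨y, s, rfl⟩ := List.exists_cons_of_ne_nil (T.isTableau.ne_nil s hs)
  exact h.1

theorem left_one (T : Tableau) : T.left 1 = column T.col T.col_sorted := by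
  refine row_ext fun i => ?_
  rw [row_left, row_column, getElem?_col]
  cases T.row i <;> rfl

theorem col_left_one (T : Tableau) : (T.left 1).col = T.col := by
  rw [left_one, col_column]

theorem exists_mem_col_le (T : Tableau) {i : ℕ} {y : ℤ} (hy : y ∈ T.row i) :
    ∃ x ∈ T.col[i]?, x ≤ y := by
  have hsorted := T.row_sorted i
  rw [getElem?_col]
  cases h : T.row i with
  | nil => simp [h] at hy
  | cons x r =>
    rw [h, List.pairwise_cons] at hsorted
    rw [h, List.mem_cons] at hy
    exact ⟨x, rfl, hy.elim (fun h => h.ge) (hsorted.1 y)⟩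

theorem dominates_col_right_one (T : Tableau) : Dominates T.col (T.right 1).col := by
  refine dominates_iff_getElem?.2 fun i y hy => T.exists_mem_col_le ?_
  rw [getElem?_col, row_right] at hy
  exact List.mem_of_mem_drop (List.mem_of_mem_head? hy)

theorem fitsLeft_column {l : List ℤ} {T : Tableau} (hc : l.Pairwise (· < ·))
    (h : Dominates l T.col) : FitsLeft 1 (column l hc) T := by
  have hle (i : ℕ) (y : ℤ) (hy : y ∈ T.row i) : ∃ x ∈ l[i]?, x ≤ y := by
    obtain ⟨z, hz, hzy⟩ := T.exists_mem_col_le hy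
    obtain ⟨x, hx, hxz⟩ := dominates_iff_getElem?.1 h i z hz
    exact ⟨x, hx, hxz.trans hzy⟩
  refine ⟨fun i => ?_, fun i y hy => ?_, fun i x hx y hy => ?_⟩ <;> rw [row_column] at *
  · cases l[i]? <;> simp
  · obtain ⟨x, hx, -⟩ := hle i y hy
    simp [Option.mem_def.1 hx]
  · obtain ⟨z, hz, hzy⟩ := hle i y hy
    rw [Option.mem_toList] at hx
    exact Option.mem_unique hx hz ▸ hzy

/-- The box bumped out when `p` is column-inserted into the first column of `X`, or `∅`. -/
def colBumped (p : ℤ) (X : Tableau) : Tableau := (colBump p X.col).1.elim ∅ single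

theorem single_mul (p : ℤ) (X : Tableau) :
    single p * X = column (colBump p X.col).2 (colBump_sorted X.col_sorted) *
      (colBumped p X * X.right 1) := by
  have hcol : single p * X.left 1 =
      column (colBump p X.col).2 (colBump_sorted X.col_sorted) * colBumped p X := by
    refine eq_of_knuthEq_word ?_
    have hbumped : (colBumped p X).word = (colBump p X.col).1.toList := by
      unfold colBumped
      cases (colBump p X.col).1 <;> rfl
    refine (knuthEq_word_mul _ _).symm.trans (.trans ?_ (knuthEq_word_mul _ _))
    rw [left_one, word_column, word_column, hbumped]
    exact knuthEq_colBump X.col_sorted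
  rw [← mul_assoc, ← hcol, mul_assoc, left_mul_right]

theorem fitsLeft_colBump (p : ℤ) (X : Tableau) :
    FitsLeft 1 (column (colBump p X.col).2 (colBump_sorted X.col_sorted))
      (colBumped p X * X.right 1) := by
  obtain ⟨m, hm⟩ : ∃ m, (X.row 0).length ≤ m := ⟨_, le_rfl⟩
  induction m generalizing p X with
  | zero =>
    have hX : X = ∅ := row_ext fun i => by
      have : (X.row i).length ≤ (X.row 0).length := X.row_length_antitone (Nat.zero_le i)
      rw [row_empty, ← List.length_eq_zero_iff]
      omega
    subst hX
    exact fitsLeft_column _ (dominates_nil _)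
  | succ m ih =>
    apply fitsLeft_column
    unfold colBumped
    cases hq : (colBump p X.col).1 with
    | none =>
      rw [Option.elim_none, Tableau.empty_mul]
      exact (dominates_colBump _ _).trans X.dominates_col_right_one
    | some q =>
      have hcol : (single q * X.right 1).col = (colBump q (X.right 1).col).2 := by
        rw [← col_left_one, single_mul, (ih q (X.right 1) ?_).left_mul, col_column]
        rw [row_right, List.length_drop]
        omega
      rw [Option.elim_some, hcol]
      exact X.dominates_col_right_one.colBump hq

theorem left_one_single_mul (p : ℤ) (X : Tableau) :
    (single p * X).left 1 = column (colBump p X.col).2 (colBump_sorted X.col_sorted) := by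
  rw [single_mul, (fitsLeft_colBump p X).left_mul]

theorem right_one_single_mul (p : ℤ) (X : Tableau) :
    (single p * X).right 1 = colBumped p X * X.right 1 := by
  rw [single_mul, (fitsLeft_colBump p X).right_mul]

theorem FixesCols.single_mul {X N : Tableau} (p : ℤ) (h : FixesCols 1 X N) :
    FixesCols 1 (single p * X) N := by
  have hcol : (X * N).col = X.col := by rw [← col_left_one, h.1, col_left_one]
  constructor
  · simp only [mul_assoc, left_one_single_mul, hcol]
  · rw [mul_assoc, right_one_single_mul, right_one_single_mul, h.2, colBumped, hcol, ← colBumped,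
      mul_assoc]

theorem induction_single_mul {motive : Tableau → Prop} (empty : motive ∅)
    (single_mul : ∀ p P, motive P → motive (single p * P)) (P : Tableau) : motive P := by
  suffices h : ∀ w : List ℤ, ∀ Q : Tableau, KnuthEq Q.word w → motive Q from h _ P (.refl _)
  intro w
  induction w with
  | nil =>
    exact fun Q hQ => eq_of_knuthEq_word (B := ∅) hQ ▸ empty
  | cons x w ih =>
    intro Q hQ
    let W : Tableau := ⟨insertWord [] w, (∅ : Tableau).isTableau.insertWord w⟩
    have hW : KnuthEq W.word w := (knuthEq_insertWord (∅ : Tableau).isTableau w).symm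
    have hQW : Q = single x * W := eq_of_knuthEq_word <|
      hQ.trans ((hW.symm.cons x).trans ((single x).knuthEq_word_mul W))
    exact hQW ▸ single_mul x W (ih W hW)

theorem FixesCols.mul_left {b : ℕ} {X N : Tableau} (h : FixesCols b X N) (P : Tableau) :
    FixesCols b (P * X) N := by
  induction b generalizing X P with
  | zero => exact fixesCols_zero _ _
  | succ b ih =>
    induction P using induction_single_mul with
    | empty => rwa [Tableau.empty_mul]
    | single_mul p P ihP =>
      rw [mul_assoc]
      refine fixesCols_succ ((ihP.mono (by omega)).single_mul p) ?_
      rw [right_one_single_mul]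
      exact ih ihP.right_one _

end Tableau

end Columns

/-! ### Left factors that leave the first rows alone -/

section LeftFactors

/-- Row-insert a word into the rows of `rs` without adding a row; the second component is the word
bumped out of the last row. -/
def bumpRows : List (List ℤ) → List ℤ → List (List ℤ) × List ℤ
  | [], w => ([], w)
  | r :: rs, w => ((bumpWord r w).2 :: (bumpRows rs (bumpWord r w).1).1,
      (bumpRows rs (bumpWord r w).1).2)

theorem insertWord_append_rows (rs ss : List (List ℤ)) (w : List ℤ) :
    insertWord (rs ++ ss) w = (bumpRows rs w).1 ++ insertWord ss (bumpRows rs w).2 := by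
  induction rs generalizing w with
  | nil => rfl
  | cons r rs ih => rw [List.cons_append, insertWord_cons, ih, bumpRows, List.cons_append]

theorem length_bumpRows (rs : List (List ℤ)) (w : List ℤ) :
    (bumpRows rs w).1.length = rs.length := by
  induction rs generalizing w with
  | nil => rfl
  | cons r rs ih => simp [bumpRows, ih]

theorem IsTableau.append {rs ss : List (List ℤ)} (hr : IsTableau rs) (hs : IsTableau ss)
    (h : ∀ r ∈ rs, ∀ s ∈ ss.head?, Above r s) : IsTableau (rs ++ ss) where
  ne_nil r hmem := (List.mem_append.1 hmem).elim (hr.ne_nil r) (hs.ne_nil r)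
  row_weak r hmem := (List.mem_append.1 hmem).elim (hr.row_weak r) (hs.row_weak r)
  col_strict := List.isChain_append.2
    ⟨hr.col_strict, hs.col_strict, fun r hr => h r (List.mem_of_getLast? hr)⟩

namespace Tableau

theorem row_zero_mul (M N : Tableau) : (M * N).row 0 = (bumpWord (M.row 0) N.word).2 := by
  rw [row, rows_mul]
  rcases eq_or_ne N.word [] with hw | hw
  · rw [hw]
    rfl
  · rw [insertWord_of_ne_nil _ hw, List.headD_eq_getD]
    rfl

theorem dominates_row_zero_mul (M N : Tableau) : Dominates ((M * N).row 0) (N.row 0) := by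
  have hN : N.row 0 = (bumpWord [] N.word).2 := by
    conv_lhs => rw [← N.empty_mul, row_zero_mul, row_empty]
  rw [hN, row_zero_mul]
  exact (dominates_nil _).bumpWord _

theorem eq_empty_of_mul_eq_empty {M N : Tableau} (h : M * N = ∅) : M = ∅ ∧ N = ∅ := by
  have hno (x : ℤ) : ¬ (M.HasEntry x ∨ N.HasEntry x) := by
    rw [← hasEntry_mul, h, hasEntry_iff_row]
    simp
  exact ⟨eq_empty_of_forall_not_hasEntry fun x hx => hno x (.inl hx),
    eq_empty_of_forall_not_hasEntry fun x hx => hno x (.inr hx)⟩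

theorem rows_top (a : ℕ) (T : Tableau) : (T.top a).rows = T.rows.take a := rfl

theorem rows_below (a : ℕ) (T : Tableau) : (T.below a).rows = T.rows.drop a := rfl

theorem below_eq_empty_iff {a : ℕ} {Y : Tableau} : Y.below a = ∅ ↔ Y.rows.length ≤ a := by
  rw [Tableau.ext_iff]
  exact List.drop_eq_nil_iff

/-- `U` has at most `a` rows and can be placed above `Z` so that the rows of `Z` start in row
`a`. -/
structure FitsAbove (a : ℕ) (U Z : Tableau) : Prop where
  length_le : U.rows.length ≤ a
  above : ∀ i < a, Above (U.row i) (Z.row 0)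

theorem FitsAbove.length_eq_or_eq_empty {a : ℕ} {U Z : Tableau} (h : FitsAbove a U Z) :
    U.rows.length = a ∨ Z = ∅ := by
  refine h.length_le.eq_or_lt.imp_right fun hlt => row_ext fun i => ?_
  have habove := h.above _ hlt
  have hanti : (Z.row i).length ≤ (Z.row 0).length := Z.row_length_antitone (Nat.zero_le i)
  rw [row_eq_nil le_rfl] at habove
  rw [row_empty]
  exact List.length_eq_zero_iff.1 (Nat.le_zero.1 (hanti.trans habove.length_le))

theorem FitsAbove.rows_mul {a : ℕ} {U Z : Tableau} (h : FitsAbove a U Z) :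
    (Z * U).rows = U.rows ++ Z.rows := by
  refine rows_mul_of_isTableau (U.isTableau.append Z.isTableau fun r hr s hs => ?_)
  obtain ⟨i, hi, rfl⟩ := List.getElem_of_mem hr
  have habove := h.above i (hi.trans_le h.length_le)
  rwa [row, List.getD_eq_getElem _ _ hi, row, ← List.headD_eq_getD, List.headD_eq_head?_getD, hs]
    at habove

theorem FitsAbove.top_mul {a : ℕ} {U Z : Tableau} (h : FitsAbove a U Z) : (Z * U).top a = U := by
  ext1
  rw [rows_top, h.rows_mul]
  rcases h.length_eq_or_eq_empty with hU | rfl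
  · exact List.take_left' hU
  · exact (congrArg (List.take a) (List.append_nil _)).trans (List.take_of_length_le h.length_le)

theorem FitsAbove.below_mul {a : ℕ} {U Z : Tableau} (h : FitsAbove a U Z) :
    (Z * U).below a = Z := by
  ext1
  rw [rows_below, h.rows_mul]
  rcases h.length_eq_or_eq_empty with hU | rfl
  · exact List.drop_left' hU
  · exact List.drop_eq_nil_of_le ((List.append_nil U.rows).symm ▸ h.length_le)

/-- Multiplying `Y` by `M` from the left does not affect the first `a` rows of `Y`. -/
def FixesRows (a : ℕ) (M Y : Tableau) : Prop :=
  (M * Y).top a = Y.top a ∧ (M * Y).below a = M * Y.below a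

theorem fixesRows_of_below_eq {a : ℕ} {Y M N : Tableau} (h : Y.below a = M * N) :
    FixesRows a M (N * Y.top a) := by
  have hY : M * (N * Y.top a) = Y := by rw [← mul_assoc, ← h, below_mul_top]
  have hfits : FitsAbove a (Y.top a) N :=
    { length_le := List.length_take_le _ _
      above := fun i hi => by
        have hN := dominates_row_zero_mul M N
        rw [← h, row_below, add_zero] at hN
        rw [row_top, if_pos hi]
        exact (Y.row_above_of_lt hi).trans_dominates hN }
  exact ⟨by rw [hY, hfits.top_mul], by rw [hY, hfits.below_mul, h]⟩

theorem rows_mul_eq_bumpRows_append (a : ℕ) (Y P : Tableau) :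
    (Y * P).rows = (bumpRows (Y.top a).rows P.word).1 ++
      insertWord (Y.below a).rows (bumpRows (Y.top a).rows P.word).2 := by
  rw [rows_mul, ← insertWord_append_rows]
  exact congrArg (insertWord · P.word) (List.take_append_drop a Y.rows).symm

theorem FixesRows.mul_right {a : ℕ} {M Y : Tableau} (h : FixesRows a M Y) (P : Tableau) :
    FixesRows a M (Y * P) := by
  rcases le_or_gt a Y.rows.length with hl | hl
  · have hlen : (bumpRows (Y.top a).rows P.word).1.length = a := by
      rw [length_bumpRows]
      exact List.length_take_of_le hl
    have hY := rows_mul_eq_bumpRows_append a Y P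
    have hMY := rows_mul_eq_bumpRows_append a (M * Y) P
    rw [h.1, h.2, mul_assoc] at hMY
    constructor <;> ext1
    · rw [rows_top, rows_top, hMY, hY, List.take_left' hlen, List.take_left' hlen]
    · have hword : ((Y * P).below a).word =
          (insertWord (Y.below a).rows (bumpRows (Y.top a).rows P.word).2).reverse.flatten := by
        rw [word, rows_below, hY, List.drop_left' hlen]
      rw [rows_below, hMY, List.drop_left' hlen, rows_mul, rows_mul, hword, ← insertWord_append]
      exact (knuthEq_insertWord (Y.below a).isTableau _).insertWord_eq M.isTableau
  · have hM : M = ∅ := by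
      have hMY : (M * Y).rows.length ≤ a := by
        have := congrArg (fun T => T.rows.length) h.1
        simp only [rows_top, List.length_take] at this
        omega
      exact (eq_empty_of_mul_eq_empty (h.2.symm.trans (below_eq_empty_iff.2 hMY))).1
    subst hM
    constructor <;> simp only [Tableau.empty_mul]

theorem top_top {a c : ℕ} (h : a ≤ c) (Y : Tableau) : (Y.top c).top a = Y.top a :=
  Tableau.ext <| by simp [top, List.take_take, h]

theorem below_eq_mul {a c : ℕ} (h : a ≤ c) (Y : Tableau) :
    Y.below a = Y.below c * (Y.top c).below a := by
  conv_lhs => rw [← below_mul_top (c - a) (Y.below a)]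
  congr 1 <;> ext1
  · simp [below, h]
  · simp [below, top, List.drop_take]

theorem FixesRows.mono {a c : ℕ} (hac : a ≤ c) {M Y : Tableau} (h : FixesRows c M Y) :
    FixesRows a M Y := by
  constructor
  · rw [← top_top hac, h.1, top_top hac]
  · rw [below_eq_mul hac (M * Y), h.1, h.2, mul_assoc, ← below_eq_mul hac]

end Tableau

end LeftFactors

/-! ### Right factors that lengthen the first columns -/

section LongerColumns

theorem length_insertRows_of_lt {rs : List (List ℤ)} (h : IsTableau rs) {x : ℤ}
    (hx : ∀ r ∈ rs.head?, ∀ y ∈ r.head?, x < y) : (insertRows rs x).length = rs.length + 1 := by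
  induction rs generalizing x with
  | nil => rfl
  | cons r rs ih =>
    obtain ⟨y, r, rfl⟩ := List.exists_cons_of_ne_nil (h.ne_nil r (by simp))
    have hy : ∀ s ∈ rs.head?, ∀ z ∈ s.head?, y < z := fun s hs z hz => by
      obtain ⟨s, rfl⟩ := List.head?_eq_some_iff.1 hz
      exact ((List.isChain_cons.1 h.col_strict).1 _ hs).1
    have hxy : x < y := hx _ rfl _ rfl
    simp only [insertRows, bump, if_pos hxy, List.length_cons, ih h.tail hy]

theorem length_zipAppend : ∀ ls rs : List (List ℤ),
    (zipAppend ls rs).length = max ls.length rs.length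
  | _, [] => (max_eq_left (Nat.zero_le _)).symm
  | [], _ :: rs => by simp [zipAppend, length_zipAppend [] rs]
  | _ :: ls, _ :: rs => by simp [zipAppend, length_zipAppend ls rs]

theorem insertRows_zipAppend_or_lt {l : List ℤ} {ts : List (List ℤ)} (hts : ts.length ≤ l.length)
    (h : IsTableau (zipAppend (l.map ([·])) ts)) (x : ℤ) :
    (insertRows (zipAppend (l.map ([·])) ts) x = zipAppend (l.map ([·])) (insertRows ts x) ∧
      (insertRows ts x).length ≤ l.length) ∨
    l.length < (insertRows (zipAppend (l.map ([·])) ts) x).length := by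
  induction l generalizing ts x with
  | nil =>
    obtain rfl := List.length_eq_zero_iff.1 (Nat.le_zero.1 hts)
    exact .inr one_pos
  | cons c l ih =>
    rcases lt_or_ge x c with hxc | hcx
    · right
      rw [length_insertRows_of_lt h (by cases ts <;> simpa [zipAppend] using hxc),
        length_zipAppend, List.length_map]
      omega
    cases ts with
    | nil => exact .inl ⟨by simp [zipAppend, insertRows, bump, not_lt.2 hcx], by simp [insertRows]⟩
    | cons t ts =>
      rw [List.length_cons, List.length_cons, Nat.succ_le_succ_iff] at hts
      cases hb : (bump x t).1 with
      | none => exact .inl ⟨by simp [zipAppend, insertRows, bump, hb, not_lt.2 hcx],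
          by simpa [insertRows, hb] using hts⟩
      | some y => simpa [zipAppend, insertRows, bump, hb, not_lt.2 hcx] using ih hts h.tail y

theorem length_flatten_le : ∀ {rs ss : List (List ℤ)},
    (∀ i, (rs.getD i []).length ≤ (ss.getD i []).length) → rs.flatten.length ≤ ss.flatten.length
  | [], _, _ => Nat.zero_le _
  | r :: rs, ss, h => by
    have hr : r.length ≤ (ss.headD []).length := by
      simpa only [List.headD_eq_getD, List.getD_cons_zero] using h 0
    have hrs : rs.flatten.length ≤ ss.tail.flatten.length := length_flatten_le fun i => by
      simpa [List.getD_eq_getElem?_getD] using h (i + 1)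
    have hss : ss.flatten.length = (ss.headD []).length + ss.tail.flatten.length := by
      cases ss <;> simp
    rw [List.flatten_cons, List.length_append, hss]
    exact Nat.add_le_add hr hrs

namespace Tableau

theorem length_word_le {A B : Tableau} (h : ∀ i, (A.row i).length ≤ (B.row i).length) :
    A.word.length ≤ B.word.length := by
  rw [word, word, A.rows.reverse_perm.flatten.length_eq, B.rows.reverse_perm.flatten.length_eq]
  exact length_flatten_le h

theorem length_rows_le {A B : Tableau} (h : ∀ i, (A.row i).length ≤ (B.row i).length) :
    A.rows.length ≤ B.rows.length := by
  by_contra! hlt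
  have hrow := h B.rows.length
  rw [row_eq_nil (T := B) le_rfl, List.length_nil, Nat.le_zero, List.length_eq_zero_iff] at hrow
  exact row_ne_nil hlt hrow

theorem length_row_le_mul (M N : Tableau) (i : ℕ) : (M.row i).length ≤ ((M * N).row i).length :=
  (dominates_row_mul M N i).length_le

theorem length_word_left_one (X : Tableau) : (X.left 1).word.length = X.rows.length := by
  rw [left_one, word_column, List.length_reverse, col, List.length_map]

theorem length_word_left_succ (b : ℕ) (X : Tableau) :
    (X.left (b + 1)).word.length = X.rows.length + ((X.right 1).left b).word.length := by
  rw [← length_word_left_one, ← left_left (Nat.le_add_left 1 b), ← length_word_mul]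
  conv_lhs => rw [← left_mul_right 1 (X.left (b + 1)), ← right_left, Nat.add_sub_cancel]

theorem fitsLeft_column_of_rows_eq {l : List ℤ} (hc : l.Pairwise (· < ·)) {T W : Tableau}
    (hW : W.rows = zipAppend (l.map ([·])) T.rows) (hlen : T.rows.length ≤ l.length) :
    FitsLeft 1 (column l hc) T := by
  have hrow (i : ℕ) : W.row i = (column l hc).row i ++ T.row i := by
    rw [row, hW, getD_zipAppend]
    rfl
  refine ⟨fun i => ?_, fun i y hy => ?_, fun i => ?_⟩
  · rw [row_column]
    cases l[i]? <;> simp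
  · have hi : i < l.length := by
      refine lt_of_lt_of_le (lt_of_not_ge fun h => ?_) hlen
      rw [row_eq_nil h] at hy
      exact List.not_mem_nil hy
    rw [row_column, List.getElem?_eq_getElem hi]
    rfl
  · have hsorted := W.row_sorted i
    rw [hrow, List.pairwise_append] at hsorted
    exact hsorted.2.2

theorem fixesCols_one_single_or_lt (X : Tableau) (x : ℤ) :
    FixesCols 1 X (single x) ∨ X.rows.length < (X * single x).rows.length := by
  have hX : X.rows = zipAppend (X.col.map ([·])) (X.right 1).rows := by
    conv_lhs => rw [← left_mul_right 1 X, rows_mul_of_le (fitsLeft_left_right 1 X).le, left_one]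
    rfl
  have hmul : X * single x = X.left 1 * (X.right 1 * single x) := by
    rw [← mul_assoc, left_mul_right]
  have hlen : (X.right 1).rows.length ≤ X.col.length := by
    rw [col, List.length_map]
    refine length_rows_le fun i => ?_
    rw [row_right, List.length_drop]
    exact Nat.sub_le _ _
  rcases insertRows_zipAppend_or_lt hlen (hX ▸ X.isTableau) x with ⟨h, hle⟩ | h
  · left
    have hfits : FitsLeft 1 (X.left 1) (X.right 1 * single x) := by
      rw [left_one]
      refine fitsLeft_column_of_rows_eq X.col_sorted (W := X * single x) ?_ ?_ <;>
        rw [rows_mul (X.right 1)]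
      exacts [(rows_mul _ _).trans ((congrArg (insertRows · x) hX).trans h), hle]
    exact ⟨hmul ▸ hfits.left_mul, hmul ▸ hfits.right_mul⟩
  · right
    rw [← hX] at h
    rw [rows_mul]
    exact (List.length_map _).symm.trans_lt h

theorem fixesCols_one_or_lt (X N : Tableau) :
    FixesCols 1 X N ∨ X.rows.length < (X * N).rows.length := by
  induction N using induction_single_mul generalizing X with
  | empty => exact .inl ⟨rfl, rfl⟩
  | single_mul p N ih =>
    rw [← mul_assoc]
    rcases fixesCols_one_single_or_lt X p with h | h
    · refine (ih (X * single p)).imp (fun h' => ⟨?_, ?_⟩) fun h' =>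
        (length_rows_le (length_row_le_mul _ _)).trans_lt h'
      · rw [← mul_assoc, h'.1, h.1]
      · rw [← mul_assoc, h'.2, h.2, mul_assoc]
    · exact .inr (h.trans_le (length_rows_le (length_row_le_mul _ _)))

theorem fixesCols_or_lt (b : ℕ) (X N : Tableau) :
    FixesCols b X N ∨ (X.left b).word.length < ((X * N).left b).word.length := by
  induction b generalizing X with
  | zero => exact .inl (fixesCols_zero X N)
  | succ b ih =>
    rw [length_word_left_succ, length_word_left_succ]
    rcases fixesCols_one_or_lt X N with hone | hlt
    · refine (ih (X.right 1)).imp (fixesCols_succ hone) fun h => ?_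
      rw [← length_word_left_one (X * N), hone.1, hone.2, length_word_left_one]
      exact Nat.add_lt_add_left h _
    · refine .inr (add_lt_add_of_lt_of_le hlt (length_word_le fun i => ?_))
      have hrow := length_row_le_mul X N i
      simp only [row_left, row_right, List.length_take, List.length_drop]
      omega

end Tableau

end LongerColumns

/-! ### Products with a rectangular tableau of small entries -/

section Rectangles

theorem insertWord_eq_cons {t : List ℤ} {ls : List (List ℤ)} (h : IsTableau (t :: ls)) :
    insertWord ls t = t :: ls := by
  have hsorted := h.row_weak t (by simp)
  induction ls generalizing t with
  | nil =>
    have hbump := bumpWord_of_above (v := []) hsorted (above_nil t) (.inr rfl)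
    rw [List.append_nil, List.append_nil] at hbump
    rw [insertWord_of_ne_nil _ (h.ne_nil t (by simp)), List.headD_nil, hbump]
    rfl
  | cons l ls ih =>
    have hbump := bumpWord_of_above (v := []) hsorted (List.isChain_cons_cons.1 h.col_strict).1
      (.inr rfl)
    rw [List.append_nil, List.append_nil] at hbump
    rw [insertWord_cons, hbump, ih h.tail (h.row_weak l (by simp))]

theorem insertWord_zipAppend_cons {b : ℕ} {t : List ℤ} {ls rs : List (List ℤ)}
    (h : IsTableau (t :: ls)) (ht : t.length = b)
    (hls : ∀ i < rs.length, (ls.getD i []).length = b) :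
    insertWord (zipAppend ls rs) t = zipAppend (t :: ls) rs := by
  induction rs generalizing t ls with
  | nil => exact insertWord_eq_cons h
  | cons r rs ih =>
    have hl : (ls.getD 0 []).length = b := hls 0 (by simp)
    cases ls with
    | nil =>
      refine absurd ?_ (h.ne_nil t (by simp))
      rwa [List.getD_nil, ← ht, eq_comm, List.length_nil, List.length_eq_zero_iff] at hl
    | cons l ls =>
      have hbump := bumpWord_of_above (v := r) (h.row_weak t (by simp))
        (List.isChain_cons_cons.1 h.col_strict).1 (.inl (ht.trans hl.symm))
      have htail := ih h.tail hl fun i hi => by simpa using hls (i + 1) (by simpa using hi)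
      rw [zipAppend, List.headD_cons, List.tail_cons, insertWord_cons, hbump, htail]
      rfl

theorem length_getD_append {b m : ℕ} {ts ls : List (List ℤ)} (ht : ∀ t ∈ ts, t.length = b)
    (hls : ∀ i < m, (ls.getD i []).length = b) :
    ∀ i < m, ((ts ++ ls).getD i []).length = b := by
  intro i hi
  rcases lt_or_ge i ts.length with h | h
  · rw [List.getD_append _ _ _ _ h, List.getD_eq_getElem _ _ h]
    exact ht _ (List.getElem_mem h)
  · rw [List.getD_append_right _ _ _ _ h]
    exact hls _ (by omega)

theorem insertWord_zipAppend_append {b : ℕ} {ts ls rs : List (List ℤ)} (h : IsTableau (ts ++ ls))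
    (ht : ∀ t ∈ ts, t.length = b) (hls : ∀ i < rs.length, (ls.getD i []).length = b) :
    insertWord (zipAppend ls rs) ts.reverse.flatten = zipAppend (ts ++ ls) rs := by
  induction ts with
  | nil => rfl
  | cons t ts ih =>
    rw [List.forall_mem_cons] at ht
    rw [List.reverse_cons, List.flatten_append, insertWord_append, ih h.tail ht.2,
      List.flatten_singleton]
    exact insertWord_zipAppend_cons h ht.1 (length_getD_append ht.2 hls)

namespace Tableau

/-- All entries of `T` are strictly smaller than all entries of `X`. -/
def Smaller (T X : Tableau) : Prop := ∀ t, T.HasEntry t → ∀ x, X.HasEntry x → t < x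

theorem Smaller.mono {T X Y : Tableau} (h : Smaller T X) (hXY : ∀ y, Y.HasEntry y → X.HasEntry y) :
    Smaller T Y := fun t ht y hy => h t ht y (hXY y hy)

theorem Smaller.mul {T X Y : Tableau} (hX : Smaller T X) (hY : Smaller T Y) :
    Smaller T (X * Y) := fun t ht x hx => (hasEntry_mul.1 hx).elim (hX t ht x) (hY t ht x)

theorem Smaller.lt_of_mem_row {T X : Tableau} (h : Smaller T X) {i j : ℕ} {x y : ℤ}
    (hx : x ∈ T.row i) (hy : y ∈ X.row j) : x < y :=
  h x (hasEntry_iff_row.2 ⟨i, hx⟩) y (hasEntry_iff_row.2 ⟨j, hy⟩)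

theorem IsRect.length_row {a b : ℕ} {T : Tableau} (h : T.IsRect a b) {i : ℕ} (hi : i < a) :
    (T.row i).length = b := (h i).trans (if_pos hi)

theorem IsRect.row_eq_nil {a b : ℕ} {T : Tableau} (h : T.IsRect a b) {i : ℕ} (hi : a ≤ i) :
    T.row i = [] := List.length_eq_zero_iff.1 ((h i).trans (if_neg (not_lt.2 hi)))

theorem IsRect.length_rows_le {a b : ℕ} {T : Tableau} (h : T.IsRect a b) : T.rows.length ≤ a :=
  le_of_not_gt fun ha => row_ne_nil ha (h.row_eq_nil le_rfl)

theorem IsRect.length_of_mem_rows {a b : ℕ} {T : Tableau} (h : T.IsRect a b) :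
    ∀ t ∈ T.rows, t.length = b := by
  intro t ht
  obtain ⟨i, hi, rfl⟩ := List.getElem_of_mem ht
  rw [← h.length_row (hi.trans_le h.length_rows_le), row, List.getD_eq_getElem _ _ hi]

theorem IsRect.mul_eq_below_mul_mul_top {a b : ℕ} {T Y : Tableau} (hT : T.IsRect a b)
    (h : Smaller T Y) : T * Y = Y.below a * T * Y.top a := by
  have htop : Smaller T (Y.top a) := h.mono fun _ => .of_top
  rw [mul_assoc, ← below_mul_top a (T * Y)]
  congr 1 <;> refine row_ext fun i => ?_
  · rw [row_below, row_below, row_mul_of_le fun _ _ hx _ hy => (h.lt_of_mem_row hx hy).le,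
      hT.row_eq_nil (by omega), List.nil_append]
  · rw [row_top, row_mul_of_le fun _ _ hx _ hy => (h.lt_of_mem_row hx hy).le,
      row_mul_of_le fun _ _ hx _ hy => (htop.lt_of_mem_row hx hy).le, row_top]
    split_ifs with hi
    · rfl
    · rw [hT.row_eq_nil (by omega), List.append_nil]

theorem IsRect.fitsAbove_left {a b : ℕ} {T X : Tableau} (hT : T.IsRect a b) (h : Smaller T X) :
    FitsAbove a T (X.left b) where
  length_le := hT.length_rows_le
  above i hi := by
    refine above_of_forall_lt ?_ fun x hx y hy =>
      (h.mono fun _ => HasEntry.of_left).lt_of_mem_row hx hy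
    rw [hT.length_row hi, row_left]
    exact List.length_take_le _ _

theorem IsRect.le_of_mem_row_left_mul {a b : ℕ} {T X : Tableau} (hT : T.IsRect a b)
    (h : Smaller T X) (i : ℕ) : ∀ x ∈ (X.left b * T).row i, ∀ y ∈ (X.right b).row i, x ≤ y := by
  intro x hx y hy
  have hfits := hT.fitsAbove_left h
  rcases lt_or_ge i a with hi | hi
  · have htop : (X.left b * T).row i = T.row i := by
      conv_rhs => rw [← hfits.top_mul, row_top, if_pos hi]
    rw [htop] at hx
    exact ((h.mono fun _ => HasEntry.of_right).lt_of_mem_row hx hy).le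
  · obtain ⟨k, rfl⟩ := Nat.exists_eq_add_of_le hi
    rw [← row_below, hfits.below_mul] at hx
    obtain ⟨z, hz, hzy⟩ := (X.right b).exists_le_of_mem_row (Nat.le_add_left k a) hy
    exact ((fitsLeft_left_right b X).le k x hx z hz).trans hzy

theorem IsRect.mul_eq_left_mul_mul_right {a b : ℕ} {X T : Tableau} (hT : T.IsRect a b)
    (h : Smaller T X) : X * T = X.left b * T * X.right b := by
  have hstack := (hT.fitsAbove_left h).rows_mul
  have hX := rows_mul_of_le (fitsLeft_left_right b X).le
  rw [left_mul_right] at hX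
  have hlen : ∀ i < (X.right b).rows.length, ((X.left b).rows.getD i []).length = b := by
    intro i hi
    obtain ⟨y, hy⟩ := List.exists_mem_of_ne_nil _ (row_ne_nil hi)
    exact le_antisymm ((fitsLeft_left_right b X).length_le i)
      ((fitsLeft_left_right b X).le_length i y hy)
  ext1
  rw [rows_mul_of_le (hT.le_of_mem_row_left_mul h), hstack, rows_mul, hX]
  exact insertWord_zipAppend_append (hstack ▸ (X.left b * T).isTableau) hT.length_of_mem_rows hlen

theorem right_left_self (b : ℕ) (X : Tableau) : (X.left b).right b = ∅ :=
  row_ext fun i => by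
    rw [row_right, row_left, row_empty, List.drop_eq_nil_of_le (List.length_take_le _ _)]

theorem IsRect.fitsLeft_top {a b : ℕ} {T Y : Tableau} (hT : T.IsRect a b) (hY : Smaller T Y) :
    FitsLeft b T (Y.top a) where
  length_le i := (hT i).trans_le (by split_ifs <;> simp)
  le_length i y hy := by
    rw [row_top] at hy
    split_ifs at hy with hi
    · exact (hT.length_row hi).ge
    · exact absurd hy List.not_mem_nil
  le _ _ hx _ hy := ((hY.mono fun _ => .of_top).lt_of_mem_row hx hy).le

theorem IsRect.fitsAbove_mul_top {a b : ℕ} {T Q Y : Tableau} (hT : T.IsRect a b)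
    (hQ : Smaller T Q) (hY : Smaller T Y) (hQY : Q.right b = Y.below a) :
    FitsAbove a (T * Y.top a) Q := by
  have hrow (i : ℕ) : (T * Y.top a).row i = T.row i ++ (Y.top a).row i :=
    row_mul_of_le (hT.fitsLeft_top hY).le i
  refine ⟨le_of_not_gt fun ha => row_ne_nil ha ?_, fun i hi => ?_⟩
  · rw [hrow, hT.row_eq_nil le_rfl, row_top, if_neg (lt_irrefl a), List.append_nil]
  · have hdrop : (Q.row 0).drop b = Y.row a := by rw [← row_right, hQY, row_below, add_zero]
    rw [hrow, row_top, if_pos hi, ← List.take_append_drop b (Q.row 0), hdrop]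
    refine (above_of_forall_lt ?_ fun x hx y hy => hQ.lt_of_mem_row hx (List.mem_of_mem_take hy))
      |>.append (Y.row_above_of_lt hi) ?_
    · exact (List.length_take_le _ _).trans_eq (hT.length_row hi).symm
    · rw [← hdrop, List.drop_eq_nil_iff, List.length_take, hT.length_row hi]
      omega

theorem IsRect.hasCorner_mul {a b : ℕ} {T Q Y : Tableau} (hT : T.IsRect a b)
    (hQ : Smaller T Q) (hY : Smaller T Y) (hQY : Q.right b = Y.below a) :
    (Q * T * Y.top a).HasCorner a b T ∧ (Q * T * Y.top a).below a = Q ∧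
      ((Q * T * Y.top a).top a).right b = Y.top a := by
  have hleft := hT.fitsLeft_top hY
  have habove := hT.fitsAbove_mul_top hQ hY hQY
  rw [mul_assoc]
  refine ⟨⟨fun i hi => ?_, ?_⟩, habove.below_mul, ?_⟩
  · have hrow : (Q * (T * Y.top a)).row i = (T * Y.top a).row i := by
      conv_rhs => rw [← habove.top_mul, row_top, if_pos hi]
    change b ≤ ((Q * (T * Y.top a)).row i).length
    rw [hrow, row_mul_of_le hleft.le, List.length_append, hT.length_row hi]
    exact Nat.le_add_right _ _
  · rw [habove.top_mul, hleft.left_mul]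
  · rw [habove.top_mul, hleft.right_mul]

theorem models_left {a b : ℕ} {T X Y : Tableau} (hX : Smaller T X) (hY : Smaller T Y) :
    Models a b T (X, Y) (X.left b, X.right b * Y) :=
  ⟨fun t ht => ⟨hX t ht, hY t ht⟩, .inl ⟨∅, X.right b, (Tableau.empty_mul _).symm, rfl, rfl⟩⟩

theorem models_below {a b : ℕ} {T X Y : Tableau} (hX : Smaller T X) (hY : Smaller T Y) :
    Models a b T (X, Y) (X * Y.below a, Y.top a) :=
  ⟨fun t ht => ⟨hX t ht, hY t ht⟩, .inr ⟨Y.below a, ∅, rfl, rfl, (Tableau.empty_mul _).symm⟩⟩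

theorem IsRect.mul_mul_eq {a b : ℕ} {T X Y : Tableau} (hT : T.IsRect a b) (hX : Smaller T X)
    (hY : Smaller T Y) : X * T * Y =
      X.left b * (X.right b * Y).below a * T * (X.right b * Y).top a := by
  have hXY : Smaller T (X.right b * Y) := (hX.mono fun _ => .of_right).mul hY
  rw [hT.mul_eq_left_mul_mul_right hX, mul_assoc (X.left b * T), mul_assoc (X.left b),
    hT.mul_eq_below_mul_mul_top hXY, mul_assoc (X.left b), mul_assoc (X.left b)]

theorem IsRect.reaches {a b : ℕ} {T : Tableau} (hT : T.IsRect a b) {X Y : Tableau}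
    (hX : Smaller T X) (hY : Smaller T Y) :
    (X * T * Y).HasCorner a b T ∧ Relation.ReflTransGen (Models a b T) (X, Y)
      ((X * T * Y).below a, ((X * T * Y).top a).right b) := by
  obtain ⟨m, hm⟩ : ∃ m, X.word.length + Y.word.length ≤ m + (X.left b).word.length :=
    ⟨X.word.length + Y.word.length, by omega⟩
  induction m using Nat.strong_induction_on generalizing X Y with | _ m ih
  set Y₁ := X.right b * Y with hY₁
  have hX₀ : Smaller T (X.left b) := hX.mono fun _ => .of_left
  have hs₁ : Smaller T Y₁ := (hX.mono fun _ => .of_right).mul hY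
  have hQ : Smaller T (X.left b * Y₁.below a) := hX₀.mul (hs₁.mono fun _ => .of_below)
  have hsteps := (Relation.ReflTransGen.single (models_left (a := a) (b := b) hX hY)).tail
    (models_below hX₀ hs₁)
  rw [hT.mul_mul_eq hX hY]
  -- Either the two steps arrive at the simple factorization, or the first factor gains boxes in its
  -- first `b` columns, which can happen only finitely often.
  rcases fixesCols_or_lt b (X.left b) (Y₁.below a) with h | h
  · have hQY : (X.left b * Y₁.below a).right b = Y₁.below a := by
      rw [h.2, right_left_self, Tableau.empty_mul]
    obtain ⟨hcorner, hbelow, htop⟩ := hT.hasCorner_mul hQ hs₁ hQY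
    rw [← hY₁, hbelow, htop]
    exact ⟨hcorner, hsteps⟩
  · rw [left_left le_rfl] at h
    have hsize : (X.left b * Y₁.below a).word.length + (Y₁.top a).word.length =
        X.word.length + Y.word.length := by
      rw [← length_word_mul, ← length_word_mul, mul_assoc, below_mul_top, hY₁, ← mul_assoc,
        left_mul_right]
    have hleft := length_word_mul ((X.left b * Y₁.below a).left b) ((X.left b * Y₁.below a).right b)
    rw [left_mul_right] at hleft
    have hK : Smaller T (Y₁.top a) := hs₁.mono fun _ => .of_top
    obtain ⟨hcorner, hreach⟩ := ih (m - 1) (by omega) hQ hK (by omega)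
    exact ⟨hcorner, hsteps.trans hreach⟩

end Tableau

end Rectangles

/-! ### Paths and labelled paths -/

section LabeledPaths

open Step Tableau

/-- The displacement of a step. -/
def Step.vec : Step → ℕ × ℕ
  | down => (0, 1)
  | up => (1, 0)
  | horiz => (1, 1)

@[simp] theorem endpoint_nil : endpoint [] = 0 := rfl

@[simp] theorem endpoint_cons (s : Step) (γ : List Step) :
    endpoint (s :: γ) = s.vec + endpoint γ := by
  cases s <;> simp [endpoint, Step.vec] <;> omega

@[simp] theorem endpoint_append (γ δ : List Step) :
    endpoint (γ ++ δ) = endpoint γ + endpoint δ := by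
  induction γ with
  | nil => simp
  | cons s γ ih => simp [ih, add_assoc]

theorem prefix_append_iff {ε γ δ : List Step} :
    ε <+: γ ++ δ ↔ ε <+: γ ∨ ∃ ζ, ε = γ ++ ζ ∧ ζ <+: δ := by
  constructor
  · intro h
    rcases List.prefix_or_prefix_of_prefix h (List.prefix_append γ δ) with hγ | ⟨ζ, rfl⟩
    · exact .inl hγ
    · exact .inr ⟨ζ, rfl, (List.prefix_append_right_inj γ).1 h⟩
  · rintro (h | ⟨ζ, rfl, h⟩)
    · exact h.trans (List.prefix_append γ δ)
    · exact (List.prefix_append_right_inj γ).2 h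

theorem IsPath.replace {n : ℕ} {α σ τ β : List Step} (h : IsPath n (α ++ (σ ++ β)))
    (hτσ : endpoint τ = endpoint σ)
    (hτ : ∀ ε, ε <+: τ → (endpoint (α ++ ε)).1 ≤ (endpoint (α ++ ε)).2) :
    IsPath n (α ++ (τ ++ β)) := by
  refine ⟨by simpa only [endpoint_append, hτσ] using h.1, fun ε hε => ?_⟩
  rcases prefix_append_iff.1 hε with hα | ⟨ζ, rfl, hζ⟩
  · exact h.2 ε (hα.trans (List.prefix_append _ _))
  rcases prefix_append_iff.1 hζ with hζτ | ⟨η, rfl, hη⟩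
  · exact hτ ζ hζτ
  · have hle := h.2 (α ++ (σ ++ η)) (by simpa using hη)
    simpa only [endpoint_append, hτσ] using hle

theorem prefix_cons_iff {ε δ : List Step} {s : Step} :
    ε <+: s :: δ ↔ ε = [] ∨ ∃ ζ, ε = s :: ζ ∧ ζ <+: δ := by
  cases ε <;> simp [List.cons_prefix_cons, eq_comm]

theorem IsPath.replace_horiz {n : ℕ} {α σ β : List Step} (h : IsPath n (α ++ (σ ++ β)))
    (hσ : endpoint σ = (1, 1)) : IsPath n (α ++ horiz :: β) := by
  have hα : (endpoint α).1 ≤ (endpoint α).2 := h.2 α (List.prefix_append _ _)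
  refine h.replace (τ := [horiz]) hσ.symm fun ε hε => ?_
  simp only [prefix_cons_iff, List.prefix_nil] at hε
  rcases hε with rfl | ⟨_, rfl, rfl⟩
  · simpa using hα
  · simpa [Step.vec] using hα

theorem IsPath.down_up_of_horiz {n : ℕ} {α β : List Step} (h : IsPath n (α ++ horiz :: β)) :
    IsPath n (α ++ down :: up :: β) := by
  have hα : (endpoint α).1 ≤ (endpoint α).2 := h.2 α (List.prefix_append _ _)
  refine h.replace (σ := [horiz]) (τ := [down, up]) rfl fun ε hε => ?_
  simp only [prefix_cons_iff, List.prefix_nil] at hε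
  rcases hε with rfl | ⟨_, rfl, rfl | ⟨_, rfl, rfl⟩⟩
  · simpa using hα
  · simpa [Step.vec] using hα.trans (Nat.le_succ _)
  · simpa [Step.vec] using hα

theorem isPath_lowest (n : ℕ) : IsPath n (List.replicate n down ++ List.replicate n up) := by
  refine ⟨by simp [endpoint, List.count_replicate], fun ε hε => ?_⟩
  simp only [prefix_append_iff, List.prefix_replicate_iff] at hε
  rcases hε with ⟨-, hε⟩ | ⟨ζ, rfl, hζ, hζ'⟩
  · rw [hε]
    simp [endpoint, List.count_replicate]
  · rw [hζ']
    simpa [endpoint, List.count_replicate] using hζ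

/-- The steps of a labelled path. Labelled paths are lists of pairs, so that a path and its labels
are cut at the same place. -/
def steps (l : List (Step × Tableau)) : List Step := l.map Prod.fst

@[simp] theorem steps_cons (x : Step × Tableau) (l : List (Step × Tableau)) :
    steps (x :: l) = x.1 :: steps l := rfl

@[simp] theorem steps_append (l m : List (Step × Tableau)) :
    steps (l ++ m) = steps l ++ steps m := List.map_append

/-- The point reached by a labelled path that starts at `(0, 0)`. -/
def point (l : List (Step × Tableau)) : ℕ × ℕ := endpoint (steps l)

@[simp] theorem point_nil : point [] = 0 := rfl

@[simp] theorem point_cons (x : Step × Tableau) (l : List (Step × Tableau)) :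
    point (x :: l) = x.1.vec + point l := endpoint_cons x.1 (steps l)

@[simp] theorem point_append (l m : List (Step × Tableau)) :
    point (l ++ m) = point l + point m := by simp [point]

theorem point_congr {l l' : List (Step × Tableau)} (h : steps l' = steps l) :
    point l' = point l := by rw [point, h, point]

theorem point_up_down (l m : List (Step × Tableau)) (P Q W : Tableau) :
    point (l ++ (up, P) :: (down, Q) :: m) = point (l ++ (horiz, W) :: m) := by
  simp only [point_append, point_cons, ← add_assoc (Step.vec _)]
  rfl

theorem point_down_up (l m : List (Step × Tableau)) (P Q W : Tableau) :
    point (l ++ (down, Q) :: (up, P) :: m) = point (l ++ (horiz, W) :: m) := by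
  simp only [point_append, point_cons, ← add_assoc (Step.vec _)]
  rfl

theorem point_snd_eq_zero {m : List (Step × Tableau)} (h : ∀ t ∈ m, t.1 = up) :
    (point m).2 = 0 := by
  induction m with
  | nil => rfl
  | cons x m ih => simp_all [Step.vec]

theorem point_fst_eq_zero {m : List (Step × Tableau)} (h : ∀ t ∈ m, t.1 = down) :
    (point m).1 = 0 := by
  induction m with
  | nil => rfl
  | cons x m ih => simp_all [Step.vec]

end LabeledPaths

/-! ### Factor sequences as labelled paths -/

section FactorPaths

open Step Tableau

variable {n : ℕ} {R : RectDiagram n}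

/-- The tableau in the triangle below a horizontal step that starts at the point `p`. -/
def TableauDiagram.at (𝒯 : TableauDiagram R) (p : ℕ × ℕ) : Tableau := 𝒯.T p.1 (p.2 + 1)

/-- The number of rows of the tableau `𝒯.at p`. -/
def RectDiagram.numRowsAt (R : RectDiagram n) (p : ℕ × ℕ) : ℕ := R.numRows p.1 (p.2 + 1)

/-- The number of columns of the tableau `𝒯.at p`. -/
def RectDiagram.numColsAt (R : RectDiagram n) (p : ℕ × ℕ) : ℕ := R.numCols p.1 (p.2 + 1)

/-- Factor sequences, each presented together with its path as a labelled path. The condition on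
paths is left out where it is automatic, see `IsFactorPath.isPath`. -/
inductive IsFactorPath (𝒯 : TableauDiagram R) : List (Step × Tableau) → Prop
  | lowest : IsFactorPath 𝒯 (List.replicate n (down, ∅) ++ List.replicate n (up, ∅))
  | split {l m : List (Step × Tableau)} {P Q : Tableau}
      (hp : IsPath n (steps (l ++ (up, P) :: (down, Q) :: m)))
      (h : IsFactorPath 𝒯 (l ++ (horiz, P * Q) :: m)) :
      IsFactorPath 𝒯 (l ++ (up, P) :: (down, Q) :: m)
  | merge {l m : List (Step × Tableau)} {Q P : Tableau}
      (h : IsFactorPath 𝒯 (l ++ (down, Q) :: (up, P) :: m)) :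
      IsFactorPath 𝒯 (l ++ (horiz, Q * 𝒯.at (point l) * P) :: m)

variable {𝒯 : TableauDiagram R}

theorem IsFactorPath.isPath {l : List (Step × Tableau)} (h : IsFactorPath 𝒯 l) :
    IsPath n (steps l) := by
  induction h with
  | lowest => simpa [steps] using isPath_lowest n
  | split hp _ _ => exact hp
  | merge _ ih =>
    rw [steps_append, steps_cons, steps_cons] at ih
    rw [steps_append, steps_cons]
    exact ih.replace_horiz (σ := [down, up]) rfl

theorem IsFactorPath.point_le {l m : List (Step × Tableau)} (h : IsFactorPath 𝒯 (l ++ m)) :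
    (point l).1 ≤ (point l).2 :=
  h.isPath.2 (steps l) (by simp)

theorem IsFactorPath.point_add {l m : List (Step × Tableau)} (h : IsFactorPath 𝒯 (l ++ m)) :
    point l + point m = (n, n) := by
  rw [← point_append]
  exact h.isPath.1

theorem IsFactorPath.point_snd_lt {l m : List (Step × Tableau)} {X : Tableau}
    (h : IsFactorPath 𝒯 (l ++ (down, X) :: m)) : (point l).2 < n := by
  have hsnd := congrArg Prod.snd h.point_add
  simp only [point_cons, Step.vec, Prod.snd_add] at hsnd
  omega

theorem IsFactorPath.eq_of_forall_up {l m : List (Step × Tableau)}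
    (h : IsFactorPath 𝒯 (l ++ m)) (hm : ∀ t ∈ m, t.1 = up) : (point l).2 = n := by
  have hsnd := congrArg Prod.snd h.point_add
  rwa [Prod.snd_add, point_snd_eq_zero hm] at hsnd

theorem length_eq_and_zip_append_iff {β₁ β₂ : Type*} {p : List (β₁ × β₂) → Prop}
    {α σ β : List β₁} {A S B : List β₂} (hA : A.length = α.length) (hS : S.length = σ.length) :
    ((α ++ σ ++ β).length = (A ++ S ++ B).length ∧ p ((α ++ σ ++ β).zip (A ++ S ++ B))) ↔
      β.length = B.length ∧ p (α.zip A ++ σ.zip S ++ β.zip B) := by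
  rw [List.zip_append (by simp [hA, hS]), List.zip_append hA.symm]
  simp [hA, hS]

theorem IsFactorSeq.isFactorPath {γ : List Step} {L : List Tableau} (h : IsFactorSeq 𝒯 γ L) :
    γ.length = L.length ∧ IsFactorPath 𝒯 (γ.zip L) := by
  induction h with
  | lowest =>
    refine ⟨by simp; omega, ?_⟩
    rw [two_mul, List.replicate_add, List.zip_append (by simp), List.zip_replicate',
      List.zip_replicate']
    exact .lowest
  | @case1 α γ γ' A B P Q hγ hA _ ih =>
    obtain ⟨β, rfl, rfl⟩ := hγ.exists_rest
    rw [length_eq_and_zip_append_iff hA rfl, List.append_assoc] at ih ⊢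
    refine ⟨ih.1, .split ?_ ih.2⟩
    simpa [steps, List.map_fst_zip, hA.ge, ih.1.le] using hγ.isPath
  | @case2 α γ γ' i j A B Q P hγ hA _ ih =>
    obtain ⟨β, rfl, rfl⟩ := hγ.exists_rest
    rw [length_eq_and_zip_append_iff hA rfl, List.append_assoc] at ih ⊢
    have hT : 𝒯.at (point (α.zip A)) = 𝒯.T i j := by
      have hs : steps (α.zip A) = α := List.map_fst_zip hA.ge
      rw [point, hs, hγ.start, TableauDiagram.at, Nat.sub_add_cancel hγ.pos]
    exact ⟨ih.1, hT ▸ IsFactorPath.merge ih.2⟩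

theorem IsFactorPath.isFactorSeq {l : List (Step × Tableau)} (h : IsFactorPath 𝒯 l) :
    IsFactorSeq 𝒯 (steps l) (l.map Prod.snd) := by
  induction h with
  | lowest =>
    have hlowest := IsFactorSeq.lowest (𝒯 := 𝒯)
    rw [two_mul, List.replicate_add] at hlowest
    simpa [steps] using hlowest
  | @split l m P Q hp h ih =>
    have hcase : IsCase1 n (steps l) (steps (l ++ (up, P) :: (down, Q) :: m))
        (steps (l ++ (horiz, P * Q) :: m)) := ⟨hp, h.isPath, steps m, by simp, by simp⟩
    simpa using IsFactorSeq.case1 (A := l.map Prod.snd) (B := m.map Prod.snd) P Q hcase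
      (by simp [steps]) (by simpa using ih)
  | @merge l m Q P h ih =>
    have hcase : IsCase2 n (steps l) (point l).1 ((point l).2 + 1)
        (steps (l ++ (horiz, Q * 𝒯.at (point l) * P) :: m))
        (steps (l ++ (down, Q) :: (up, P) :: m)) :=
      ⟨h.merge.isPath, h.isPath, ⟨steps m, by simp, by simp⟩, rfl, Nat.succ_pos _⟩
    simpa [TableauDiagram.at] using IsFactorSeq.case2 (A := l.map Prod.snd)
      (B := m.map Prod.snd) Q P hcase (by simp [steps]) (by simpa using ih)

theorem isFactorSeq_append_iff {α σ β : List Step} {A S B : List Tableau}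
    (hA : A.length = α.length) (hS : S.length = σ.length) :
    IsFactorSeq 𝒯 (α ++ σ ++ β) (A ++ S ++ B) ↔
      β.length = B.length ∧ IsFactorPath 𝒯 (α.zip A ++ (σ.zip S ++ β.zip B)) := by
  rw [← List.append_assoc, ← length_eq_and_zip_append_iff hA hS]
  refine ⟨IsFactorSeq.isFactorPath, fun ⟨hlen, h⟩ => ?_⟩
  have hseq := h.isFactorSeq
  rwa [steps, List.map_fst_zip hlen.le, List.map_snd_zip hlen.ge] at hseq

/-! ### Inversion of the two rules -/

theorem append_cons_eq_append_cons {β : Type*} {l m l' m' : List β} {x y : β}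
    (h : l ++ x :: m = l' ++ y :: m') :
    (l = l' ∧ x = y ∧ m = m') ∨ (∃ c, l' = l ++ x :: c ∧ m = c ++ y :: m') ∨
      ∃ c, l = l' ++ y :: c ∧ m' = c ++ x :: m := by
  simp only [List.append_eq_append_iff, List.cons_eq_append_iff, List.cons_eq_cons] at h
  rcases h with ⟨_, rfl, ⟨rfl, rfl, rfl⟩ | ⟨c, rfl, rfl⟩⟩ |
    ⟨_, rfl, ⟨rfl, rfl, rfl⟩ | ⟨c, rfl, rfl⟩⟩
  · exact .inl ⟨(List.append_nil l).symm, rfl, rfl⟩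
  · exact .inr (.inl ⟨c, rfl, rfl⟩)
  · exact .inl ⟨List.append_nil l', rfl, rfl⟩
  · exact .inr (.inr ⟨c, rfl, rfl⟩)

theorem cons_eq_append_cons_of_ne {β : Type*} {c m m' : List β} {x y : β}
    (h : x :: m = c ++ y :: m') (hne : x ≠ y) : ∃ c', c = x :: c' ∧ m = c' ++ y :: m' := by
  rcases List.cons_eq_append_iff.1 h with ⟨-, hy⟩ | hc
  · exact absurd (List.cons_eq_cons.1 hy).1.symm hne
  · exact hc

theorem lowest_ne_up_down {l m : List (Step × Tableau)} {P Q : Tableau} :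
    List.replicate n (down, ∅) ++ List.replicate n (up, ∅) ≠ l ++ (up, P) :: (down, Q) :: m := by
  intro h
  have hpairwise : (List.replicate n ((down, ∅) : Step × Tableau) ++
      List.replicate n (up, ∅)).Pairwise fun x y : Step × Tableau => ¬ (x.1 = up ∧ y.1 = down) := by
    simp [List.pairwise_append, List.pairwise_replicate, List.mem_replicate]
  simp [h, List.pairwise_append] at hpairwise

theorem lowest_ne_horiz {l m : List (Step × Tableau)} {W : Tableau} :
    List.replicate n (down, ∅) ++ List.replicate n (up, ∅) ≠ l ++ (horiz, W) :: m := by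
  intro h
  have hmem : (horiz, W) ∈ l ++ (horiz, W) :: m := by simp
  simp [← h, List.mem_replicate] at hmem

theorem IsFactorPath.up_down_inv {l m : List (Step × Tableau)} {P Q : Tableau}
    (h : IsFactorPath 𝒯 (l ++ (up, P) :: (down, Q) :: m)) :
    IsFactorPath 𝒯 (l ++ (horiz, P * Q) :: m) := by
  generalize hk : l ++ (up, P) :: (down, Q) :: m = k at h
  induction h generalizing l m with
  | lowest => exact absurd hk.symm lowest_ne_up_down
  | @split l' m' P' Q' hp h ih =>
    have hpath : IsPath n (steps (l ++ (horiz, P * Q) :: m)) := by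
      rw [← hk, steps_append] at hp
      rw [steps_append]
      exact hp.replace_horiz (σ := [up, down]) rfl
    rcases append_cons_eq_append_cons hk with ⟨rfl, hP, hQ⟩ | ⟨c, rfl, hc⟩ | ⟨c, rfl, hc⟩
    · cases hP
      cases hQ
      exact h
    · obtain ⟨c, rfl, rfl⟩ := cons_eq_append_cons_of_ne hc (by simp)
      have hlow := ih (l := l) (m := c ++ (horiz, P' * Q') :: m') (by simp)
      simpa using IsFactorPath.split (l := l ++ (horiz, P * Q) :: c) (by simpa using hpath)
        (by simpa using hlow)
    · obtain ⟨c, rfl, rfl⟩ := cons_eq_append_cons_of_ne hc (by simp)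
      have hlow := ih (l := l' ++ (horiz, P' * Q') :: c) (m := m) (by simp)
      simpa using IsFactorPath.split (m := c ++ (horiz, P * Q) :: m) (by simpa using hpath)
        (by simpa using hlow)
  | @merge l' m' Q' P' h ih =>
    rcases append_cons_eq_append_cons hk with ⟨-, hP, -⟩ | ⟨c, rfl, hc⟩ | ⟨c, rfl, rfl⟩
    · simp at hP
    · obtain ⟨c, rfl, rfl⟩ := cons_eq_append_cons_of_ne hc (by simp)
      have hlow := ih (l := l) (m := c ++ (down, Q') :: (up, P') :: m') (by simp)
      have hmerge := IsFactorPath.merge (l := l ++ (horiz, P * Q) :: c) (by simpa using hlow)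
      rw [← point_up_down l c P Q] at hmerge
      simpa using hmerge
    · have hlow := ih (l := l' ++ (down, Q') :: (up, P') :: c) (m := m) (by simp)
      simpa using IsFactorPath.merge (m := c ++ (horiz, P * Q) :: m) (by simpa using hlow)

theorem IsFactorPath.horiz_inv {l m : List (Step × Tableau)} {W : Tableau}
    (h : IsFactorPath 𝒯 (l ++ (horiz, W) :: m)) :
    ∃ Q P, W = Q * 𝒯.at (point l) * P ∧ IsFactorPath 𝒯 (l ++ (down, Q) :: (up, P) :: m) := by
  generalize hk : l ++ (horiz, W) :: m = k at h
  induction h generalizing l m with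
  | lowest => exact absurd hk.symm lowest_ne_horiz
  | @split l' m' P' Q' hp h ih =>
    have hpath : IsPath n (steps l ++ down :: up :: steps m) :=
      IsPath.down_up_of_horiz (by simpa [← hk] using hp)
    rcases append_cons_eq_append_cons hk with ⟨-, hP, -⟩ | ⟨c, rfl, rfl⟩ | ⟨c, rfl, hc⟩
    · simp at hP
    · obtain ⟨Q, P, hW, hlow⟩ := ih (l := l) (m := c ++ (horiz, P' * Q') :: m') (by simp)
      refine ⟨Q, P, hW, ?_⟩
      simpa using IsFactorPath.split (l := l ++ (down, Q) :: (up, P) :: c) (by simpa using hpath)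
        (by simpa using hlow)
    · obtain ⟨c, rfl, rfl⟩ := cons_eq_append_cons_of_ne hc (by simp)
      obtain ⟨Q, P, hW, hlow⟩ := ih (l := l' ++ (horiz, P' * Q') :: c) (m := m) (by simp)
      refine ⟨Q, P, by rwa [point_up_down l' c P' Q' (P' * Q')], ?_⟩
      simpa using IsFactorPath.split (m := c ++ (down, Q) :: (up, P) :: m) (by simpa using hpath)
        (by simpa using hlow)
  | @merge l' m' Q' P' h ih =>
    rcases append_cons_eq_append_cons hk with ⟨rfl, hW, rfl⟩ | ⟨c, rfl, rfl⟩ | ⟨c, rfl, rfl⟩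
    · cases hW
      exact ⟨Q', P', rfl, h⟩
    · obtain ⟨Q, P, hW, hlow⟩ := ih (l := l) (m := c ++ (down, Q') :: (up, P') :: m') (by simp)
      have hmerge := IsFactorPath.merge (l := l ++ (down, Q) :: (up, P) :: c)
        (by simpa using hlow)
      rw [point_down_up l c P Q W] at hmerge
      exact ⟨Q, P, hW, by simpa using hmerge⟩
    · obtain ⟨Q, P, hW, hlow⟩ := ih (l := l' ++ (down, Q') :: (up, P') :: c) (m := m) (by simp)
      refine ⟨Q, P, by rwa [point_down_up] at hW, ?_⟩
      simpa using IsFactorPath.merge (m := c ++ (down, Q) :: (up, P) :: m) (by simpa using hlow)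

/-! ### The entries of a factor sequence -/

/-- The entries of `X` are entries of rectangles `(k, l)` that lie below a step `s` starting at
the point `p`: those with `p.2 < l` and `k < p.1`, and also `k = p.1` unless `s` goes down. -/
def EntriesBelow (𝒯 : TableauDiagram R) (p : ℕ × ℕ) (s : Step) (X : Tableau) : Prop :=
  ∀ x, X.HasEntry x → ∃ k l, (𝒯.T k l).HasEntry x ∧ l ≤ n ∧ p.2 < l ∧
    (k < p.1 ∨ (s ≠ down ∧ k = p.1))

theorem entriesBelow_empty (p : ℕ × ℕ) (s : Step) : EntriesBelow 𝒯 p s ∅ := by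
  rintro x ⟨r, hr, -⟩
  exact absurd hr List.not_mem_nil

theorem EntriesBelow.up_down {p : ℕ × ℕ} {P Q : Tableau} (h : EntriesBelow 𝒯 p horiz (P * Q)) :
    EntriesBelow 𝒯 p up P ∧ EntriesBelow 𝒯 (p + up.vec) down Q := by
  constructor <;> intro x hx
  · obtain ⟨k, l, hkl, hln, hpl, hkp⟩ := h x (hasEntry_mul.2 (.inl hx))
    exact ⟨k, l, hkl, hln, hpl, by simpa using hkp⟩
  · obtain ⟨k, l, hkl, hln, hpl, hkp⟩ := h x (hasEntry_mul.2 (.inr hx))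
    exact ⟨k, l, hkl, hln, hpl, .inl (Nat.lt_succ_of_le (hkp.elim le_of_lt fun h => h.2.le))⟩

theorem EntriesBelow.horiz {p : ℕ × ℕ} {Q P : Tableau} (hp : p.2 < n)
    (hQ : EntriesBelow 𝒯 p down Q) (hP : EntriesBelow 𝒯 (p + down.vec) up P) :
    EntriesBelow 𝒯 p horiz (Q * 𝒯.at p * P) := by
  intro x hx
  simp only [hasEntry_mul] at hx
  rcases hx with (hx | hx) | hx
  · obtain ⟨k, l, hkl, hln, hpl, hkp⟩ := hQ x hx
    exact ⟨k, l, hkl, hln, hpl, hkp.imp_right fun h => absurd rfl h.1⟩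
  · exact ⟨p.1, p.2 + 1, hx, hp, Nat.lt_succ_self _, .inr ⟨by simp, rfl⟩⟩
  · obtain ⟨k, l, hkl, hln, hpl, hkp⟩ := hP x hx
    exact ⟨k, l, hkl, hln, (Nat.lt_succ_self _).trans hpl, by simpa [Step.vec] using hkp⟩

/-- All labels of a path that starts at `p` satisfy `EntriesBelow`. -/
def LabelsBelow (𝒯 : TableauDiagram R) : ℕ × ℕ → List (Step × Tableau) → Prop
  | _, [] => True
  | p, x :: l => EntriesBelow 𝒯 p x.1 x.2 ∧ LabelsBelow 𝒯 (p + x.1.vec) l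

theorem labelsBelow_append {p : ℕ × ℕ} {l m : List (Step × Tableau)} :
    LabelsBelow 𝒯 p (l ++ m) ↔ LabelsBelow 𝒯 p l ∧ LabelsBelow 𝒯 (p + point l) m := by
  induction l generalizing p with
  | nil => simp [LabelsBelow]
  | cons x l ih => simp [LabelsBelow, ih, and_assoc, add_assoc]

theorem labelsBelow_replicate (p : ℕ × ℕ) (s : Step) (k : ℕ) :
    LabelsBelow 𝒯 p (List.replicate k (s, ∅)) := by
  induction k generalizing p with
  | zero => trivial
  | succ k ih => exact ⟨entriesBelow_empty p s, ih _⟩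

theorem IsFactorPath.labelsBelow {l : List (Step × Tableau)} (h : IsFactorPath 𝒯 l) :
    LabelsBelow 𝒯 0 l := by
  induction h with
  | lowest =>
    exact labelsBelow_append.2 ⟨labelsBelow_replicate _ _ _, labelsBelow_replicate _ _ _⟩
  | split _ _ ih =>
    obtain ⟨hl, hPQ, hm⟩ := labelsBelow_append.1 ih
    exact labelsBelow_append.2 ⟨hl, hPQ.up_down.1, hPQ.up_down.2, by rwa [add_assoc]⟩
  | merge h ih =>
    obtain ⟨hl, hQ, hP, hm⟩ := labelsBelow_append.1 ih
    rw [zero_add] at hQ hP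
    refine labelsBelow_append.2 ⟨hl, ?_, by rwa [add_assoc] at hm⟩
    rw [zero_add]
    exact hQ.horiz h.point_snd_lt hP

theorem IsFactorPath.entriesBelow {l m : List (Step × Tableau)} {s : Step} {X : Tableau}
    (h : IsFactorPath 𝒯 (l ++ (s, X) :: m)) : EntriesBelow 𝒯 (point l) s X := by
  simpa using (labelsBelow_append.1 h.labelsBelow).2.1

theorem smaller_at {p : ℕ × ℕ} {X : Tableau} (hp : p.1 ≤ p.2)
    (h : ∀ x, X.HasEntry x → ∃ k l, (𝒯.T k l).HasEntry x ∧ l ≤ n ∧ k ≤ p.1 ∧ p.2 < l ∧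
      (p.1, p.2 + 1) ≠ (k, l)) : Smaller (𝒯.at p) X := by
  intro t ht x hx
  obtain ⟨k, l, hkl, hln, hk, hl, hne⟩ := h x hx
  exact 𝒯.entry_lt k l _ _ hk (Nat.lt_succ_of_le hp) hl hln hne t x ht hkl

theorem IsFactorPath.smaller {l m : List (Step × Tableau)} {X Y : Tableau}
    (h : IsFactorPath 𝒯 (l ++ (down, X) :: (up, Y) :: m)) :
    Smaller (𝒯.at (point l)) X ∧ Smaller (𝒯.at (point l)) Y := by
  refine ⟨smaller_at h.point_le fun x hx => ?_, smaller_at h.point_le fun y hy => ?_⟩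
  · obtain ⟨k, l', hkl, hln, hpl, hkp⟩ := h.entriesBelow x hx
    have hk : k < (point l).1 := hkp.resolve_right fun h => h.1 rfl
    exact ⟨k, l', hkl, hln, hk.le, hpl, fun heq => hk.ne' (congrArg Prod.fst heq)⟩
  · have hY : EntriesBelow 𝒯 (point (l ++ [(down, X)])) up Y :=
      IsFactorPath.entriesBelow (m := m) (by simpa using h)
    obtain ⟨k, l', hkl, hln, hpl, hkp⟩ := hY y hy
    simp only [point_append, point_cons, point_nil, Step.vec, Prod.fst_add, Prod.snd_add,
      add_zero] at hpl hkp
    exact ⟨k, l', hkl, hln, by omega, by omega, fun heq => hpl.ne (congrArg Prod.snd heq)⟩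

theorem IsFactorPath.eq_empty_of_fst_eq_zero {l m : List (Step × Tableau)} {X : Tableau}
    (h : IsFactorPath 𝒯 (l ++ (down, X) :: m)) (hl : (point l).1 = 0) : X = ∅ := by
  refine eq_empty_of_forall_not_hasEntry fun x hx => ?_
  obtain ⟨k, l', -, -, -, hk⟩ := h.entriesBelow x hx
  simp [hl] at hk

theorem IsFactorPath.eq_empty_of_snd_eq {l m : List (Step × Tableau)} {s : Step} {X : Tableau}
    (h : IsFactorPath 𝒯 (l ++ (s, X) :: m)) (hl : (point l).2 = n) : X = ∅ := by
  refine eq_empty_of_forall_not_hasEntry fun x hx => ?_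
  obtain ⟨k, l', -, hln, hlt, -⟩ := h.entriesBelow x hx
  omega

/-! ### Moving factors past a vertex -/

theorem IsFactorPath.exists_down_of_horiz {l m : List (Step × Tableau)} {V : Tableau}
    (h : IsFactorPath 𝒯 (l ++ (horiz, V) :: m)) :
    ∃ X m', IsFactorPath 𝒯 (l ++ (down, X) :: m') ∧ ∀ l' N, steps l' = steps l →
      IsFactorPath 𝒯 (l' ++ (down, N * X) :: m') →
      IsFactorPath 𝒯 (l' ++ (horiz, N * V) :: m) := by
  obtain ⟨Q, P, rfl, hQP⟩ := h.horiz_inv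
  refine ⟨Q, (up, P) :: m, hQP, fun l' N hl h' => ?_⟩
  have hmerge := h'.merge
  rwa [point_congr hl, mul_assoc N, mul_assoc N] at hmerge

/-- The path is lowered until it goes down after `l`. This can be undone even if the label after `l`
has been multiplied by some `N` in the meantime, which is how a factor gets past a vertex. -/
theorem IsFactorPath.exists_down {l m : List (Step × Tableau)} {s : Step} {V : Tableau}
    (hs : s ≠ up ∨ ∃ t ∈ m, t.1 ≠ up) (h : IsFactorPath 𝒯 (l ++ (s, V) :: m)) :
    ∃ X m', IsFactorPath 𝒯 (l ++ (down, X) :: m') ∧ ∀ l' N, steps l' = steps l →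
      IsFactorPath 𝒯 (l' ++ (down, N * X) :: m') → IsFactorPath 𝒯 (l' ++ (s, N * V) :: m) := by
  induction m generalizing l s V with
  | nil =>
    cases s with
    | down => exact ⟨V, [], h, fun _ _ _ h => h⟩
    | up => simp at hs
    | horiz => exact h.exists_down_of_horiz
  | cons x m ih =>
    cases s with
    | down => exact ⟨V, _, h, fun _ _ _ h => h⟩
    | horiz => exact h.exists_down_of_horiz
    | up =>
      obtain ⟨X', m', h₁, h₂⟩ := ih (l := l ++ [(up, V)]) (s := x.1) (V := x.2)
        (by simpa using hs) (by simpa using h)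
      rw [List.append_assoc, List.singleton_append] at h₁
      obtain ⟨Q, P, hQP, h₃⟩ := h₁.up_down_inv.horiz_inv
      refine ⟨Q, (up, P) :: m', h₃, fun l' N hl h' => ?_⟩
      have hmerge := h'.merge
      rw [point_congr hl, mul_assoc N, mul_assoc N, ← hQP, ← mul_assoc] at hmerge
      have hsplit := IsFactorPath.split (by simpa [hl] using h₁.isPath) hmerge
      simpa using h₂ (l' ++ [(up, N * V)]) ∅ (by simp [hl]) (by simpa using hsplit)

theorem IsFactorPath.exists_up_of_horiz {l m : List (Step × Tableau)} {V : Tableau}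
    (h : IsFactorPath 𝒯 (l ++ (horiz, V) :: m)) :
    ∃ X l', point l' + up.vec = point l + horiz.vec ∧ IsFactorPath 𝒯 (l' ++ (up, X) :: m) ∧
      ∀ m' N, IsFactorPath 𝒯 (l' ++ (up, X * N) :: m') →
      IsFactorPath 𝒯 (l ++ (horiz, V * N) :: m') := by
  obtain ⟨Q, P, rfl, hQP⟩ := h.horiz_inv
  refine ⟨P, l ++ [(down, Q)], by simp [Step.vec, add_assoc], by simpa using hQP,
    fun m' N h' => ?_⟩
  rw [mul_assoc]
  exact .merge (by simpa using h')

theorem IsFactorPath.exists_up {l m : List (Step × Tableau)} {s : Step} {V : Tableau}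
    (hs : s ≠ down ∨ ∃ t ∈ l, t.1 ≠ down) (h : IsFactorPath 𝒯 (l ++ (s, V) :: m)) :
    ∃ X l', point l' + up.vec = point l + s.vec ∧ IsFactorPath 𝒯 (l' ++ (up, X) :: m) ∧
      ∀ m' N, steps m' = steps m → IsFactorPath 𝒯 (l' ++ (up, X * N) :: m') →
      IsFactorPath 𝒯 (l ++ (s, V * N) :: m') := by
  induction l using List.reverseRecOn generalizing s V m with
  | nil =>
    cases s with
    | down => simp at hs
    | up => exact ⟨V, [], rfl, h, fun _ _ _ h => h⟩
    | horiz =>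
      obtain ⟨X, l', hp, hX, hup⟩ := h.exists_up_of_horiz
      exact ⟨X, l', hp, hX, fun m' N _ => hup m' N⟩
  | append_singleton l x ih =>
    cases s with
    | up => exact ⟨V, _, rfl, h, fun _ _ _ h => h⟩
    | horiz =>
      obtain ⟨X, l', hp, hX, hup⟩ := h.exists_up_of_horiz
      exact ⟨X, l', hp, hX, fun m' N _ => hup m' N⟩
    | down =>
      obtain ⟨X', l', hp, h₁, h₂⟩ := ih (s := x.1) (V := x.2) (m := (down, V) :: m)
        (by simpa [or_comm] using hs) (by simpa using h)
      obtain ⟨Q, P, hQP, h₃⟩ := h₁.up_down_inv.horiz_inv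
      refine ⟨P, l' ++ [(down, Q)], ?_, by simpa using h₃, fun m' N hm h' => ?_⟩
      · simp only [point_append, point_cons, point_nil, add_zero, ← hp, add_assoc,
          add_comm up.vec]
      have hmerge := IsFactorPath.merge (l := l') (Q := Q) (P := P * N) (by simpa using h')
      rw [← mul_assoc, ← hQP, mul_assoc] at hmerge
      have hsplit := IsFactorPath.split (by simpa [hm] using h₁.isPath) hmerge
      simpa using h₂ ((down, V * N) :: m') ∅ (by simp [hm]) (by simpa using hsplit)

theorem IsFactorPath.move_right_of_up {l m : List (Step × Tableau)} {s : Step} {Y N V : Tableau}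
    (h : IsFactorPath 𝒯 (l ++ (up, Y * N) :: (s, V) :: m)) :
    IsFactorPath 𝒯 (l ++ (up, Y) :: (s, N * V) :: m) := by
  by_cases hs : s ≠ up ∨ ∃ t ∈ m, t.1 ≠ up
  · obtain ⟨X, m', h₁, h₂⟩ :=
      IsFactorPath.exists_down (l := l ++ [(up, Y * N)]) hs (by simpa using h)
    rw [List.append_assoc, List.singleton_append] at h₁
    have hmerged := h₁.up_down_inv
    rw [mul_assoc] at hmerged
    have hsplit := IsFactorPath.split (by simpa using h₁.isPath) hmerged
    simpa using h₂ (l ++ [(up, Y)]) N (by simp) (by simpa using hsplit)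
  · push Not at hs
    obtain ⟨rfl, rfl⟩ := eq_empty_of_mul_eq_empty <|
      h.eq_empty_of_snd_eq (h.eq_of_forall_up (by simpa using hs))
    simpa using h

theorem IsFactorPath.move_left_of_down {l m : List (Step × Tableau)} {s : Step} {V N Y : Tableau}
    (h : IsFactorPath 𝒯 (l ++ (s, V) :: (down, N * Y) :: m)) :
    IsFactorPath 𝒯 (l ++ (s, V * N) :: (down, Y) :: m) := by
  by_cases hs : s ≠ down ∨ ∃ t ∈ l, t.1 ≠ down
  · obtain ⟨X, l', -, h₁, h₂⟩ := h.exists_up hs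
    have hmerged := h₁.up_down_inv
    rw [← mul_assoc] at hmerged
    exact h₂ ((down, Y) :: m) N (by simp) (.split (by simpa using h₁.isPath) hmerged)
  · push Not at hs
    have hfst : (point (l ++ [(s, V)])).1 = 0 :=
      point_fst_eq_zero fun t ht => by
        rcases List.mem_append.1 ht with ht | ht
        · exact hs.2 t ht
        · exact (List.mem_singleton.1 ht).symm ▸ hs.1
    obtain ⟨rfl, rfl⟩ := eq_empty_of_mul_eq_empty <|
      IsFactorPath.eq_empty_of_fst_eq_zero (m := m) (by simpa using h) hfst
    simpa using h

/-- Every horizontal step that starts at `p` may be replaced according to any simple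
factorization of its label. -/
def SimpleFactorizationsLift (𝒯 : TableauDiagram R) (p : ℕ × ℕ) : Prop :=
  ∀ l m W, point l = p → IsFactorPath 𝒯 (l ++ (horiz, W) :: m) →
    W.HasCorner (R.numRowsAt p) (R.numColsAt p) (𝒯.at p) ∧
    ∀ Q P, IsSimpleFactorization (R.numRowsAt p) (R.numColsAt p) W Q (𝒯.at p) P →
      IsFactorPath 𝒯 (l ++ (down, Q) :: (up, P) :: m)

theorem isSimpleFactorization_right {a b : ℕ} {W T : Tableau} (h : W.HasCorner a b T) :
    (W.below a).left b * T = W.left b ∧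
      IsSimpleFactorization a b W ((W.below a).left b) T (W.right b) := by
  have hleft : (W.below a).left b * T = W.left b := by
    rw [h.2, below_left, top_left, below_mul_top]
  refine ⟨hleft, h, by rw [hleft, left_mul_right], ∅, (W.below a).right b,
    (Tableau.empty_mul _).symm, rfl, ?_⟩
  rw [below_right, top_right, below_mul_top]

theorem isSimpleFactorization_below {a b : ℕ} {W T : Tableau} (h : W.HasCorner a b T) :
    T * (W.top a).right b = W.top a ∧
      IsSimpleFactorization a b W (W.below a) T ((W.top a).right b) := by
  have htop : T * (W.top a).right b = W.top a := by rw [h.2, left_mul_right]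
  refine ⟨htop, h, by rw [mul_assoc, htop, below_mul_top], (W.below a).right b, ∅, rfl, ?_,
    (Tableau.empty_mul _).symm⟩
  rw [left_mul_right]

theorem IsFactorPath.move_right_of_horiz {l m : List (Step × Tableau)} {s : Step}
    {U N V : Tableau} {b : ℕ} (h : IsFactorPath 𝒯 (l ++ (horiz, U * N) :: (s, V) :: m))
    (hS : SimpleFactorizationsLift 𝒯 (point l)) (hb : R.numColsAt (point l) ≤ b)
    (hU : FixesCols b U N) : IsFactorPath 𝒯 (l ++ (horiz, U) :: (s, N * V) :: m) := by
  obtain ⟨hcorner, hlift⟩ := hS l _ _ rfl h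
  obtain ⟨hleft, hsimple⟩ := isSimpleFactorization_right hcorner
  have hlow := hlift _ _ hsimple
  obtain ⟨hUleft, hUright⟩ := hU.mono hb
  rw [hUright] at hlow
  have hmoved := IsFactorPath.move_right_of_up (l := l ++ [_]) (by simpa using hlow)
  rw [List.append_assoc, List.singleton_append] at hmoved
  have hmerge := hmoved.merge
  rwa [hleft, hUleft, left_mul_right] at hmerge

theorem IsFactorPath.move_left_of_horiz {l m : List (Step × Tableau)} {s : Step}
    {V M W : Tableau} {a : ℕ} (h : IsFactorPath 𝒯 (l ++ (s, V) :: (horiz, M * W) :: m))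
    (hS : SimpleFactorizationsLift 𝒯 (point l + s.vec)) (ha : R.numRowsAt (point l + s.vec) ≤ a)
    (hW : FixesRows a M W) : IsFactorPath 𝒯 (l ++ (s, V * M) :: (horiz, W) :: m) := by
  have hpoint (V' : Tableau) : point (l ++ [(s, V')]) = point l + s.vec := by simp
  obtain ⟨hcorner, hlift⟩ := hS (l ++ [(s, V)]) m _ (hpoint V) (by simpa using h)
  obtain ⟨htop, hsimple⟩ := isSimpleFactorization_below hcorner
  have hlow := hlift _ _ hsimple
  obtain ⟨hWtop, hWbelow⟩ := hW.mono ha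
  rw [hWbelow, List.append_assoc, List.singleton_append] at hlow
  have hmerge := IsFactorPath.merge (l := l ++ [(s, V * M)])
    (by simpa using hlow.move_left_of_down)
  rw [hpoint, mul_assoc, htop, hWtop, below_mul_top] at hmerge
  simpa using hmerge

theorem IsFactorPath.move_right_of_down {l m : List (Step × Tableau)} {s : Step}
    {X N V : Tableau} (h : IsFactorPath 𝒯 (l ++ (down, X * N) :: (s, V) :: m))
    (hS : ∀ i, (point l).1 = i + 1 → SimpleFactorizationsLift 𝒯 (i, (point l).2))
    (hX : FixesCols (R.numColsAt (point l)) X N) :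
    IsFactorPath 𝒯 (l ++ (down, X) :: (s, N * V) :: m) := by
  have hle := h.point_le
  have hlt := h.point_snd_lt
  by_cases hl : ∃ t ∈ l, t.1 ≠ down
  · obtain ⟨l₀, x, rfl⟩ := (List.eq_nil_or_concat' l).resolve_left (by
      rintro rfl
      simp at hl)
    obtain ⟨Z, l', hp, h₁, h₂⟩ := IsFactorPath.exists_up (l := l₀) (s := x.1) (V := x.2)
      (by simpa [or_comm] using hl) (by simpa using h)
    have hp' : point (l₀ ++ [x]) = point l' + up.vec := by simpa using hp.symm
    rw [hp'] at hX hS hle hlt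
    have hmerged := h₁.up_down_inv
    rw [← mul_assoc] at hmerged
    have hmoved := hmerged.move_right_of_horiz (hS _ rfl) (R.numCols_le _ _ (Nat.lt_succ_of_le hle)
      hlt) (hX.mul_left Z)
    have hsplit := IsFactorPath.split (by simpa using h₁.isPath) hmoved
    simpa using h₂ ((down, X) :: (s, N * V) :: m) ∅ (by simp) (by simpa using hsplit)
  · push Not at hl
    obtain ⟨rfl, rfl⟩ := eq_empty_of_mul_eq_empty <|
      h.eq_empty_of_fst_eq_zero (point_fst_eq_zero hl)
    simpa using h

theorem IsFactorPath.move_left_of_up {l m : List (Step × Tableau)} {s : Step} {V M Y : Tableau}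
    {p : ℕ × ℕ} (h : IsFactorPath 𝒯 (l ++ (s, V) :: (up, M * Y) :: m))
    (hp : point l + s.vec = p) (hlt : p.1 < p.2) (hS : p.2 < n → SimpleFactorizationsLift 𝒯 p)
    (hY : FixesRows (R.numRows p.1 p.2) M Y) :
    IsFactorPath 𝒯 (l ++ (s, V * M) :: (up, Y) :: m) := by
  subst hp
  have hpl : point (l ++ [(s, V)]) = point l + s.vec := by simp
  have h' : IsFactorPath 𝒯 ((l ++ [(s, V)]) ++ (up, M * Y) :: m) := by simpa using h
  by_cases hm : ∃ t ∈ m, t.1 ≠ up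
  · obtain ⟨x, m₀, rfl⟩ := List.exists_cons_of_ne_nil (l := m) (by
      rintro rfl
      simp at hm)
    obtain ⟨Z, m', h₁, h₂⟩ := IsFactorPath.exists_down (l := l ++ [(s, V), (up, M * Y)])
      (s := x.1) (V := x.2) (m := m₀) (by simpa using hm) (by simpa using h)
    have hn : (point l + s.vec).2 < n := by simpa [Step.vec] using h₁.point_snd_lt
    have hmerged := IsFactorPath.up_down_inv (l := l ++ [(s, V)]) (by simpa using h₁)
    rw [mul_assoc, List.append_assoc, List.singleton_append] at hmerged
    have hmoved := hmerged.move_left_of_horiz (hS hn) (R.numRows_le _ _ hlt hn)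
      (hY.mul_right Z)
    have hsplit := IsFactorPath.split (l := l ++ [(s, V * M)]) (m := m')
      (by simpa using h₁.isPath) (by simpa using hmoved)
    simpa using h₂ (l ++ [(s, V * M), (up, Y)]) ∅ (by simp) (by simpa using hsplit)
  · push Not at hm
    have hsnd : (point l + s.vec).2 = n := hpl ▸ h'.eq_of_forall_up (by simpa using hm)
    obtain ⟨rfl, rfl⟩ := eq_empty_of_mul_eq_empty <| h'.eq_empty_of_snd_eq (hpl ▸ hsnd)
    simpa using h

/-! ### The criterion for factor sequences -/

theorem IsFactorPath.models {l m : List (Step × Tableau)} {q q' : Tableau × Tableau}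
    (h : IsFactorPath 𝒯 (l ++ (down, q.1) :: (up, q.2) :: m))
    (hleft : ∀ i, (point l).1 = i + 1 → SimpleFactorizationsLift 𝒯 (i, (point l).2))
    (hright : (point l).2 + 1 < n → SimpleFactorizationsLift 𝒯 ((point l).1, (point l).2 + 1))
    (hM : Models (R.numRowsAt (point l)) (R.numColsAt (point l)) (𝒯.at (point l)) q q') :
    IsFactorPath 𝒯 (l ++ (down, q'.1) :: (up, q'.2) :: m) := by
  obtain ⟨-, ⟨M, N, hMN, hX, hY⟩ | ⟨M, N, hMN, hX, hY⟩⟩ := hM <;> rw [hX, hY]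
  · refine IsFactorPath.move_right_of_down ?_ hleft (fixesCols_of_right_eq hMN)
    rwa [mul_assoc, ← hMN, left_mul_right]
  · refine IsFactorPath.move_left_of_up (p := ((point l).1, (point l).2 + 1)) ?_ rfl
      (Nat.lt_succ_of_le h.point_le) hright (fixesRows_of_below_eq hMN)
    rwa [← mul_assoc, ← hMN, below_mul_top]

theorem IsFactorPath.reflTransGen_models {l m : List (Step × Tableau)} {q q' : Tableau × Tableau}
    (h : IsFactorPath 𝒯 (l ++ (down, q.1) :: (up, q.2) :: m))
    (hleft : ∀ i, (point l).1 = i + 1 → SimpleFactorizationsLift 𝒯 (i, (point l).2))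
    (hright : (point l).2 + 1 < n → SimpleFactorizationsLift 𝒯 ((point l).1, (point l).2 + 1))
    (hq : Relation.ReflTransGen
      (Models (R.numRowsAt (point l)) (R.numColsAt (point l)) (𝒯.at (point l))) q q') :
    IsFactorPath 𝒯 (l ++ (down, q'.1) :: (up, q'.2) :: m) := by
  induction hq with
  | refl => exact h
  | tail _ hM ih => exact ih.models hleft hright hM

theorem simpleFactorizationsLift (𝒯 : TableauDiagram R) (p : ℕ × ℕ) :
    SimpleFactorizationsLift 𝒯 p := by
  induction hk : p.1 + (n - p.2) using Nat.strong_induction_on generalizing p with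
  | _ k ih =>
    rintro l m W rfl h
    obtain ⟨X, Y, rfl, hXY⟩ := h.horiz_inv
    have hlt := hXY.point_snd_lt
    obtain ⟨hX, hY⟩ := hXY.smaller
    have hT : (𝒯.at (point l)).IsRect (R.numRowsAt (point l)) (R.numColsAt (point l)) :=
      𝒯.isRect _ _ (Nat.lt_succ_of_le h.point_le) hlt
    obtain ⟨hcorner, hreach⟩ := hT.reaches hX hY
    refine ⟨hcorner, fun Q P hQP => ?_⟩
    have hleft : ∀ i, (point l).1 = i + 1 → SimpleFactorizationsLift 𝒯 (i, (point l).2) :=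
      fun i hi => ih _ (by simp only; omega) _ rfl
    have hright : (point l).2 + 1 < n →
        SimpleFactorizationsLift 𝒯 ((point l).1, (point l).2 + 1) :=
      fun hlt' => ih _ (by simp only; omega) _ rfl
    have hnormal := IsFactorPath.reflTransGen_models (q := (X, Y)) hXY hleft hright hreach
    obtain ⟨Q', P', hZ, rfl, rfl⟩ := hQP.exists_factor
    obtain ⟨hX', hY'⟩ := hnormal.smaller
    exact IsFactorPath.models (q' := (_, _)) hnormal hleft hright
      ⟨fun t ht => ⟨hX' t ht, hY' t ht⟩, .inl ⟨Q', P', hZ, rfl, rfl⟩⟩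

theorem IsFactorPath.leads {l m : List (Step × Tableau)} {q q' : Tableau × Tableau}
    (h : IsFactorPath 𝒯 (l ++ (down, q.1) :: (up, q.2) :: m))
    (hq : Leads (R.numRowsAt (point l)) (R.numColsAt (point l)) (𝒯.at (point l)) q q') :
    IsFactorPath 𝒯 (l ++ (down, q'.1) :: (up, q'.2) :: m) :=
  h.reflTransGen_models (fun _ _ => simpleFactorizationsLift 𝒯 _)
    (fun _ => simpleFactorizationsLift 𝒯 _) hq.to_reflTransGen

end FactorPaths

end FactorSeq

open FactorSeq in
theorem mainTheorem4 {n : ℕ} (R : RectDiagram n) (𝒯 : TableauDiagram R)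
    (α γ γ' : List Step) (i j : ℕ) (hγ : IsCase2 n α i j γ γ')
    (A B : List Tableau) (hA : A.length = α.length) :
    (∀ W : Tableau, IsFactorSeq 𝒯 γ (A ++ [W] ++ B) →
      W.HasCorner (R.numRows i j) (R.numCols i j) (𝒯.T i j) ∧
      ∀ Q P : Tableau,
        IsSimpleFactorization (R.numRows i j) (R.numCols i j) W Q (𝒯.T i j) P →
        IsFactorSeq 𝒯 γ' (A ++ [Q, P] ++ B)) ∧
    (∀ X Y X' Y' : Tableau, IsFactorSeq 𝒯 γ' (A ++ [X, Y] ++ B) →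
      Leads (R.numRows i j) (R.numCols i j) (𝒯.T i j) (X, Y) (X', Y') →
      IsFactorSeq 𝒯 γ' (A ++ [X', Y'] ++ B)) := by
  obtain ⟨β, rfl, rfl⟩ := hγ.exists_rest
  obtain ⟨k, rfl⟩ : ∃ k, j = k + 1 := ⟨j - 1, (Nat.sub_add_cancel hγ.pos).symm⟩
  have hpoint : point (α.zip A) = (i, k) := by
    rw [point, steps, List.map_fst_zip hA.ge, hγ.start, Nat.add_sub_cancel]
  refine ⟨fun W hW => ?_, fun X Y X' Y' hXY hleads => ?_⟩
  · obtain ⟨hlen, hW⟩ := (isFactorSeq_append_iff hA rfl).1 hW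
    obtain ⟨hcorner, hlift⟩ := simpleFactorizationsLift 𝒯 (i, k) _ _ W hpoint hW
    exact ⟨hcorner, fun Q P hQP => (isFactorSeq_append_iff hA rfl).2 ⟨hlen, hlift Q P hQP⟩⟩
  · obtain ⟨hlen, hXY⟩ := (isFactorSeq_append_iff hA rfl).1 hXY
    have hXY' := IsFactorPath.leads (q := (X, Y)) (q' := (X', Y')) hXY (hpoint ▸ hleads)
    exact (isFactorSeq_append_iff hA rfl).2 ⟨hlen, hXY'⟩
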